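/- Let $m\ge 2$ agents have states $\eta_i(k)\in\mathbb R^n$ evolving by $$\eta_i(k+1)=S\eta_i(k)+Bu_i(k)+L_iz_i(k),\qquad k\ge 0,$$ with $S\in\mathbb R^{n\times n}$, $B\in\mathbb R^{n\times 1}$, scalar inputs $u_i(k)$, matrices $L_i\in\mathbb R^{n\times q_i}$ and noises $z_i(k)\in\mathbb R^{q_i}$. Assume that $S$ has at least one complex eigenvalue of modulus $\ge 1$ and that $(S,B)$ is controllable. Each $z_i(k)$ is square integrable with zero mean, and for each $i$ the covariance of $z_i(k)$ is bounded uniformly in $k$; the noises may otherwise be arbitrarily correlated in time, among agents, and with the states. Write $\bar\eta(k)=\frac1m\sum_i\eta_i(k)$ and $\bar L_z(k)=\frac1m\sum_i L_iz_i(k)$. The initial states $\eta_i(0)$ are random vectors such that each $\eta_i(0)-\bar\eta(0)$ is square integrable. The agents communicate over a connected undirected graph with symmetric weights $a_{ij}=a_{ji}\ge 0$ (with $i\ne j$ adjacent iff $a_{ij}>0$), whose weighted Laplacian has eigenvalues $0=\mu_1<\mu_2\le\dots\le\mu_m$. Agent $i$ broadcasts its state at the instants $k^i_0=0$ and $$k^i_{s+1}=\min\{k>k^i_s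 : \|S^{k-k^i_s}\eta_i(k^i_s)-\eta_i(k)\|^2\ge c_0+c_1\varrho^k\}$$ ($=\infty$ if there is no such $k$), where $c_0,c_1>0$ and $\varrho\in(0,1)$. Set $\hat\eta_i(k)=S^{k-k^i_s}\eta_i(k^i_s)$ for $k\in[k^i_s,k^i_{s+1})$. The control is $$u_i(k)=\Gamma\sum_{j=1}^m a_{ij}\bigl(\hat\eta_j(k)-\hat\eta_i(k)\bigr),\qquad \Gamma\in\mathbb R^{1\times n}.$$ Let $M(S)$ be the Mahler measure of $S$: the product of the moduli of its eigenvalues of modulus $\ge 1$, counted with multiplicity. Suppose $$M(S)<\frac{1+\mu_2/\mu_m}{1-\mu_2/\mu_m}$$ (the right side is read as $+\infty$ if $\mu_2=\mu_m$). Then there is $\zeta>0$ with $$M(S)<\zeta^{-1}\le\frac{1+\mu_2/\mu_m}{1-\mu_2/\mu_m},$$ and for every such $\zeta$ the following hold. (a) There is a symmetric matrix $\mathcal P>0$ with $$\mathcal P-S^T\mathcal PS+(1-\zeta^2)\frac{S^T\mathcal PBB^T\mathcal PS}{B^T\mathcal PB}>0 .$$ (b) For every such $\mathcal P$, with the gain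 $\Gamma=\frac{2}{\mu_2+\mu_m}\frac{B^T\mathcal PS}{B^T\mathcal PB}$, the event-triggered protocol achieves synchronization in the mean square sense: $\bar\eta(k+1)=S\bar\eta(k)+\bar L_z(k)$ for all $k\ge 0$, and there is a matrix $\Xi$ such that, for all $i$ and all $k\ge 0$, $\eta_i(k)-\bar\eta(k)$ is square integrable and $\operatorname{cov}(\eta_i(k)-\bar\eta(k))\le\Xi$ in the Loewner order. -/

import Mathlib

open MeasureTheory ProbabilityTheory Polynomial
open scoped Matrix

noncomputable section

namespace EventSync

/-! ### Linear algebra -/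

/-- The pair `(S, B)` (single input) is controllable: the matrix with columns
`B, S B, …, S ^ (n - 1) B` has full rank. -/
def Controllable {n : ℕ} (S : Matrix (Fin n) (Fin n) ℝ) (B : Fin n → ℝ) : Prop :=
  (Matrix.of fun (a j : Fin n) => ((S ^ (j : ℕ)) *ᵥ B) a).rank = n

/-- The complex eigenvalues of a real square matrix, with algebraic multiplicity. -/
def complexEigenvalues {n : ℕ} (S : Matrix (Fin n) (Fin n) ℝ) : Multiset ℂ :=
  (S.map (algebraMap ℝ ℂ)).charpoly.roots

open Classical in
/-- The unstable eigenvalues: those on or outside the unit circle. -/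
def unstableEigenvalues {n : ℕ} (S : Matrix (Fin n) (Fin n) ℝ) : Multiset ℂ :=
  (complexEigenvalues S).filter fun lam => 1 ≤ ‖lam‖

/-- The Mahler measure of a matrix: the absolute product of its unstable eigenvalues. -/
def mahlerOf {n : ℕ} (S : Matrix (Fin n) (Fin n) ℝ) : ℝ :=
  ((unstableEigenvalues S).map fun lam => ‖lam‖).prod

/-- `P > 0` solves the modified Riccati inequality
`P - Sᵀ P S + (1 - ζ²) (Sᵀ P B Bᵀ P S) / (Bᵀ P B) > 0`. -/
def SolvesRiccati {n : ℕ} (S : Matrix (Fin n) (Fin n) ℝ) (B : Fin n → ℝ) (ζ : ℝ)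
    (P : Matrix (Fin n) (Fin n) ℝ) : Prop :=
  P.PosDef ∧
    (P - Sᵀ * P * S + ((1 - ζ ^ 2) / (B ⬝ᵥ (P *ᵥ B))) •
      Matrix.vecMulVec ((Sᵀ * P) *ᵥ B) (B ᵥ* (P * S))).PosDef

/-- The gain `Γ = 2 / (μ₂ + μₘ) * (Bᵀ P S) / (Bᵀ P B)`, a row vector. -/
def gain {n : ℕ} (S : Matrix (Fin n) (Fin n) ℝ) (B : Fin n → ℝ) (mu2 mum : ℝ)
    (P : Matrix (Fin n) (Fin n) ℝ) : Fin n → ℝ :=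
  (2 / (mu2 + mum)) • ((B ⬝ᵥ (P *ᵥ B))⁻¹ • (B ᵥ* (P * S)))

/-! ### The communication graph -/

/-- The undirected graph with an edge between distinct `i`, `j` iff `a i j > 0`. -/
def commGraph {m : ℕ} (a : Matrix (Fin m) (Fin m) ℝ) : SimpleGraph (Fin m) :=
  SimpleGraph.fromRel fun i j => 0 < a i j

/-- The weighted Laplacian (a diagonal weight `a i i` cancels). -/
def laplacian {m : ℕ} (a : Matrix (Fin m) (Fin m) ℝ) : Matrix (Fin m) (Fin m) ℝ :=
  Matrix.diagonal (fun i => ∑ j, a i j) - a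

theorem laplacian_isHermitian {m : ℕ} {a : Matrix (Fin m) (Fin m) ℝ} (ha : a.IsSymm) :
    (laplacian a).IsHermitian := by
  unfold Matrix.IsHermitian laplacian
  rw [Matrix.conjTranspose_eq_transpose_of_trivial, Matrix.transpose_sub,
    Matrix.diagonal_transpose, ha.eq]

/-- The eigenvalues of the Laplacian, with multiplicity, in increasing order; index `j` (from `0`)
is `μ_{j+1}`. (`eigenvalues₀` lists them in decreasing order.) -/
def laplacianEig {m : ℕ} {a : Matrix (Fin m) (Fin m) ℝ} (ha : a.IsSymm) (j : Fin m) : ℝ :=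
  (laplacian_isHermitian ha).eigenvalues₀ (Fin.cast (Fintype.card_fin m).symm j.rev)

/-- `μ₂`, the second smallest Laplacian eigenvalue. -/
def mu2 {m : ℕ} {a : Matrix (Fin m) (Fin m) ℝ} (ha : a.IsSymm) (hm : 2 ≤ m) : ℝ :=
  laplacianEig ha ⟨1, by omega⟩

/-- `μₘ`, the largest Laplacian eigenvalue. -/
def muMax {m : ℕ} {a : Matrix (Fin m) (Fin m) ℝ} (ha : a.IsSymm) (hm : 2 ≤ m) : ℝ :=
  laplacianEig ha ⟨m - 1, by omega⟩

/-! ### The event trigger, for one agent along one trajectory `x` of its state -/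

/-- The triggering function `‖ε(k)‖² - (c₀ + c₁ ϱ ^ k)` (Euclidean norm) at time `k`, where
`ε(k) = S ^ (k - t) x(t) - x(k)` and `t ≤ k` is the time of the latest broadcast before `k`. -/
def triggerFun {n : ℕ} (S : Matrix (Fin n) (Fin n) ℝ) (c₀ c₁ rho : ℝ) (x : ℕ → Fin n → ℝ)
    (t k : ℕ) : ℝ :=
  ‖WithLp.toLp 2 ((S ^ (k - t)) *ᵥ x t - x k)‖ ^ 2 - (c₀ + c₁ * rho ^ k)

/-- The triggering instants: `k₀ = 0` and `k_{s+1} = min {k > k_s | f(k) ≥ 0}`, which is `⊤` when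
the agent is never triggered after `k_s`. -/
def triggerTime {n : ℕ} (S : Matrix (Fin n) (Fin n) ℝ) (c₀ c₁ rho : ℝ) (x : ℕ → Fin n → ℝ) :
    ℕ → ℕ∞
  | 0 => 0
  | s + 1 => sInf {t : ℕ∞ | ∃ k : ℕ, t = (k : ℕ∞) ∧
      triggerTime S c₀ c₁ rho x s < (k : ℕ∞) ∧
      0 ≤ triggerFun S c₀ c₁ rho x (triggerTime S c₀ c₁ rho x s).toNat k}

/-- `xhat` is the broadcast-based estimate of `x`:
`xhat(k) = S ^ (k - k_s) x(k_s)` for `k ∈ [k_s, k_{s+1})`. -/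
def IsHeldEstimate {n : ℕ} (S : Matrix (Fin n) (Fin n) ℝ) (c₀ c₁ rho : ℝ)
    (x xhat : ℕ → Fin n → ℝ) : Prop :=
  ∀ s t k : ℕ, triggerTime S c₀ c₁ rho x s = (t : ℕ∞) → t ≤ k →
    (k : ℕ∞) < triggerTime S c₀ c₁ rho x (s + 1) → xhat k = (S ^ (k - t)) *ᵥ x t

/-! ### The closed loop and mean-square synchronization -/

/-- The average of finitely many vectors. -/
def average {m n : ℕ} (x : Fin m → Fin n → ℝ) : Fin n → ℝ := (m : ℝ)⁻¹ • ∑ i, x i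

/-- `η` is a trajectory of the agents `η_i(k+1) = S η_i(k) + B u_i(k) + L_i z_i(k)` under the
event-triggered protocol `u_i(k) = Γ ∑ j, a_ij (η̂_j(k) - η̂_i(k))`. -/
def IsClosedLoop {Ω : Type*} {m n : ℕ} {q : Fin m → ℕ} (a : Matrix (Fin m) (Fin m) ℝ)
    (S : Matrix (Fin n) (Fin n) ℝ) (B : Fin n → ℝ) (Γ : Fin n → ℝ) (c₀ c₁ rho : ℝ)
    (L : (i : Fin m) → Matrix (Fin n) (Fin (q i)) ℝ)
    (z : (i : Fin m) → ℕ → Ω → Fin (q i) → ℝ) (η : Fin m → ℕ → Ω → Fin n → ℝ) : Prop :=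
  ∃ (ηhat : Fin m → ℕ → Ω → Fin n → ℝ) (u : Fin m → ℕ → Ω → ℝ),
    (∀ i ω, IsHeldEstimate S c₀ c₁ rho (fun k => η i k ω) (fun k => ηhat i k ω)) ∧
    (∀ i k ω, u i k ω = Γ ⬝ᵥ ∑ j, a i j • (ηhat j k ω - ηhat i k ω)) ∧
    (∀ i k ω, η i (k + 1) ω = S *ᵥ η i k ω + u i k ω • B + L i *ᵥ z i k ω)

/-- The covariance matrix of a random vector. -/
def covMatrix {Ω : Type*} [MeasurableSpace Ω] {d : ℕ} (X : Ω → Fin d → ℝ) (ν : Measure Ω) :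
    Matrix (Fin d) (Fin d) ℝ :=
  Matrix.of fun b c => cov[fun ω => X ω b, fun ω => X ω c; ν]

/-- Zero mean, finite second moments, and covariance bounded uniformly in time (in the Loewner
order). No independence of any kind is required. -/
def IsBoundedNoise {Ω : Type*} [MeasurableSpace Ω] {d : ℕ} (z : ℕ → Ω → Fin d → ℝ)
    (ν : Measure Ω) : Prop :=
  (∀ k, MemLp (z k) 2 ν) ∧ (∀ k, ∫ ω, z k ω ∂ν = 0) ∧
    ∃ Z : Matrix (Fin d) (Fin d) ℝ, ∀ k, (Z - covMatrix (z k) ν).PosSemidef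

/-- Synchronization in the mean square sense: consistency of the average state, and consensus with
uniformly bounded error covariance (finiteness of the second moments is part of the claim). -/
def MeanSquareSync {Ω : Type*} [MeasurableSpace Ω] {m n : ℕ} {q : Fin m → ℕ}
    (S : Matrix (Fin n) (Fin n) ℝ) (L : (i : Fin m) → Matrix (Fin n) (Fin (q i)) ℝ)
    (z : (i : Fin m) → ℕ → Ω → Fin (q i) → ℝ) (η : Fin m → ℕ → Ω → Fin n → ℝ)
    (ν : Measure Ω) : Prop :=
  (∀ k ω, average (fun i => η i (k + 1) ω) =
      S *ᵥ average (fun i => η i k ω) + average (fun i => L i *ᵥ z i k ω)) ∧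
    ∃ Ξ : Matrix (Fin n) (Fin n) ℝ, ∀ i k,
      MemLp (fun ω => η i k ω - average fun j => η j k ω) 2 ν ∧
      (Ξ - covMatrix (fun ω => η i k ω - average fun j => η j k ω) ν).PosSemidef

/-- `ζ > 0` with `mahlerOf S < ζ⁻¹ ≤ (1 + μ₂/μₘ) / (1 - μ₂/μₘ)`. The last inequality is cleared of
its denominator, so that the bound is `+∞` when `μ₂ = μₘ`. -/
def AdmissibleZeta {n : ℕ} (S : Matrix (Fin n) (Fin n) ℝ) (mu2 mum ζ : ℝ) : Prop :=
  0 < ζ ∧ mahlerOf S < ζ⁻¹ ∧ ζ⁻¹ * (1 - mu2 / mum) ≤ 1 + mu2 / mum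

end EventSync

end

noncomputable section

namespace EventSync

/-! Two facts meet in the Lyapunov function Σ D_iᵀPD_i of the disagreements D_i = η_i - η̄.
Contraction: with β = BᵀPB and κ_i = β⁻¹BᵀPSD_i, the diffusive input changes only the B-component of
SD_i, turning κ into (1 - gL)κ for the Laplacian L and g = 2/(μ₂+μₘ). On vectors of zero sum this
operator has norm at most (μₘ-μ₂)/(μₘ+μ₂) ≤ ζ. The input therefore removes at least (1-ζ²)β Σκ_i²
from Σ(SD_i)ᵀP(SD_i), which is exactly the term that the Riccati inequality provides
(`sum_sq_sub_laplacian_le`, `sum_quadForm_step_le`). The trigger keeps the estimation errors below a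
deterministic bound, and the noise is bounded in L², so a perturbed contraction in expectation
bounds all second moments. No independence enters, only Young's inequality.

Solvability: for W = P⁻¹ it is enough that SWSᵀ < W + BBᵀ and BᵀW⁻¹B ≤ ζ⁻² - 1. The first condition
reads Sᵀ(W+BBᵀ)⁻¹S < P, and Sherman-Morrison together with the second gives the Riccati inequality
(`solvesRiccati_inv`). Such a W exists once ζ⁻² exceeds M(S)² = ∏ max(1,|s|²) over the eigenvalues.
This is proved over ℂ by splitting off one eigenvalue of the observable pair (Sᵀ, Bᵀ) at a time,
each costing a factor slightly above max(1,|s|²) (`exists_lyapunov_form`); arbitrary, even repeated,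
eigenvalues are allowed. -/

/-! ### Lyapunov inequality for an observable pair, by induction on eigenvalues -/

theorem norm_add_sq_le_weighted (x y : ℂ) {a b : ℝ} (ha : 0 < a) (hb : 0 < b) :
    ‖x + y‖ ^ 2 ≤ (1 + a / b) * ‖x‖ ^ 2 + (1 + b / a) * ‖y‖ ^ 2 := by
  have h1 : ‖x + y‖ ^ 2 ≤ (‖x‖ + ‖y‖) ^ 2 := by gcongr; exact norm_add_le x y
  have h2 : (1 + a / b) * ‖x‖ ^ 2 + (1 + b / a) * ‖y‖ ^ 2 - (‖x‖ + ‖y‖) ^ 2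
      = (a * ‖x‖ - b * ‖y‖) ^ 2 / (a * b) := by field_simp; ring
  have h3 : 0 ≤ (a * ‖x‖ - b * ‖y‖) ^ 2 / (a * b) := by positivity
  linarith

/-- The two-variable inequality that lets one eigenvalue `lam` be split off. -/
theorem exists_split_constants (lam : ℂ) {τ : ℝ} (hτ : max 1 (‖lam‖ ^ 2) < τ) :
    ∃ (κ₀ : ℂ) (w r : ℝ), 0 < w ∧ 0 < r ∧ 1 / w ≤ τ - 1 ∧ w * ‖lam‖ ^ 2 < w + 1 ∧
      ∀ κ, ‖κ - κ₀‖ ≤ r → ∀ x y : ℂ,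
        w * ‖κ * y + lam * x‖ ^ 2 + τ⁻¹ * ‖y‖ ^ 2 ≤ w * ‖x‖ ^ 2 + ‖x + y‖ ^ 2 := by
  obtain ⟨t, ht, htτ⟩ := exists_between hτ
  have ht1 : 1 < t := lt_of_le_of_lt (le_max_left _ _) ht
  have htl : ‖lam‖ ^ 2 < t := lt_of_le_of_lt (le_max_right _ _) ht
  have ht0 : 0 < t := by linarith
  have hτ0 : 0 < τ := by linarith
  have hw : 0 < 1 / (t - 1) := by apply one_div_pos.mpr; linarith
  have hε : 0 < (t - 1) * (t⁻¹ - τ⁻¹) := by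
    apply mul_pos (by linarith)
    have := (inv_lt_inv₀ hτ0 ht0).mpr htτ
    linarith
  set ε := (t - 1) * (t⁻¹ - τ⁻¹) with hεd
  set l := ‖lam‖ ^ 2 with hl
  have hl0 : 0 ≤ l := by positivity
  -- κ₀ makes κ₀y + λx a multiple of the variable X that completes the square in w|x|² + |x+y|². The
  -- slack t < τ leaves an ε with wε + τ⁻¹ = t⁻¹, which absorbs the deviation h = κ - κ₀.
  refine ⟨lam * ((t - 1) / t : ℝ), 1 / (t - 1), √(ε * (1 - l / t)), hw, ?_, ?_, ?_, ?_⟩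
  · apply Real.sqrt_pos.mpr
    apply mul_pos hε
    rw [sub_pos, div_lt_one ht0]; exact htl
  · rw [one_div_one_div]; linarith
  · have : t - 1 > 0 := by linarith
    field_simp; linarith
  · intro κ hκ x y
    set h := κ - lam * ((t - 1) / t : ℝ) with hh
    have hpos : 0 ≤ ε * (1 - l / t) := by
      apply mul_nonneg hε.le
      rw [sub_nonneg, div_le_one ht0]; exact htl.le
    have hh2 : ‖h‖ ^ 2 ≤ ε * (1 - l / t) := by
      have := pow_le_pow_left₀ (norm_nonneg h) hκ 2
      rwa [Real.sq_sqrt hpos] at this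
    set X := x + ((t - 1) / t : ℝ) * y with hX
    have e1 : κ * y + lam * x = lam * X + h * y := by
      rw [hX, hh]; ring
    have key : ‖lam * X + h * y‖ ^ 2 ≤ t * ‖X‖ ^ 2 + ε * ‖y‖ ^ 2 := by
      have a1 : ‖lam * X + h * y‖ ≤ ‖lam‖ * ‖X‖ + ‖h‖ * ‖y‖ := by
        rw [← norm_mul, ← norm_mul]; exact norm_add_le _ _
      have a2 : ‖lam * X + h * y‖ ^ 2 ≤ (‖lam‖ * ‖X‖ + ‖h‖ * ‖y‖) ^ 2 := by gcongr
      refine a2.trans ?_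
      have a3 : l / t + ‖h‖ ^ 2 / ε ≤ 1 := by
        have : ‖h‖ ^ 2 / ε ≤ 1 - l / t := by rw [div_le_iff₀ hε]; linarith
        linarith
      -- Cauchy-Schwarz with weights t and ε.
      have a4 : (‖lam‖ * ‖X‖ + ‖h‖ * ‖y‖) ^ 2 ≤
          (l / t + ‖h‖ ^ 2 / ε) * (t * ‖X‖ ^ 2 + ε * ‖y‖ ^ 2) := by
        have : (l / t + ‖h‖ ^ 2 / ε) * (t * ‖X‖ ^ 2 + ε * ‖y‖ ^ 2)
            - (‖lam‖ * ‖X‖ + ‖h‖ * ‖y‖) ^ 2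
            = (ε * ‖lam‖ * ‖y‖ - t * ‖h‖ * ‖X‖) ^ 2 / (t * ε) := by
          rw [hl]; field_simp; ring
        have : 0 ≤ (ε * ‖lam‖ * ‖y‖ - t * ‖h‖ * ‖X‖) ^ 2 / (t * ε) := by positivity
        linarith
      refine a4.trans ?_
      have : 0 ≤ t * ‖X‖ ^ 2 + ε * ‖y‖ ^ 2 := by positivity
      nlinarith
    have e2 : 1 / (t - 1) * ‖x‖ ^ 2 + ‖x + y‖ ^ 2
        = t / (t - 1) * ‖X‖ ^ 2 + t⁻¹ * ‖y‖ ^ 2 := by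
      have : t - 1 ≠ 0 := by linarith
      rw [hX]
      simp only [Complex.sq_norm, Complex.normSq_apply, Complex.add_re, Complex.add_im,
        Complex.re_ofReal_mul, Complex.im_ofReal_mul]
      field_simp
      ring
    rw [e1, e2]
    have e3 : 1 / (t - 1) * (t * ‖X‖ ^ 2 + ε * ‖y‖ ^ 2) + τ⁻¹ * ‖y‖ ^ 2
        = t / (t - 1) * ‖X‖ ^ 2 + t⁻¹ * ‖y‖ ^ 2 := by
      have : t - 1 ≠ 0 := by linarith
      rw [hεd]; field_simp; ring
    rw [← e3]
    gcongr

theorem one_le_prod_max (l : List ℂ) : 1 ≤ (l.map fun s => max 1 (‖s‖ ^ 2)).prod := by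
  induction l with
  | nil => simp
  | cons a l ih =>
    rw [List.map_cons, List.prod_cons]
    exact one_le_mul_of_one_le_of_one_le (le_max_left _ _) ih

/-- A non-eigenvalue `λ - κ` with `κ` in a prescribed ball. -/
theorem exists_mem_ball_isUnit_sub {U : Type*} [AddCommGroup U] [Module ℂ U]
    [FiniteDimensional ℂ U] (T : Module.End ℂ U) (lam κ₀ : ℂ) {r : ℝ} (hr : 0 < r) :
    ∃ κ, ‖κ - κ₀‖ ≤ r ∧ κ ≠ 0 ∧ IsUnit (T - algebraMap ℂ (Module.End ℂ U) (lam - κ)) := by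
  have hfin : Set.Finite (insert (0 : ℂ) ((fun s => lam - s) '' spectrum ℂ T)) :=
    ((Module.End.finite_spectrum T).image _).insert _
  have hinf : (Metric.ball κ₀ r).Infinite := infinite_of_mem_nhds κ₀ (Metric.ball_mem_nhds κ₀ hr)
  obtain ⟨κ, hκ, hκn⟩ := (hinf.sdiff hfin).nonempty
  rw [Set.mem_insert_iff, not_or] at hκn
  refine ⟨κ, ?_, hκn.1, ?_⟩
  · rw [← dist_eq_norm]; exact (Metric.mem_ball.mp hκ).le
  · by_contra h
    apply hκn.2
    refine ⟨lam - κ, ?_, by ring⟩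
    rw [spectrum.mem_iff]
    intro h'
    apply h
    rw [← IsUnit.neg_iff, neg_sub]
    exact h'

/-- The product `∏ (T - s)` over a list of scalars. -/
def prodSub {U : Type*} [AddCommGroup U] [Module ℂ U] (T : Module.End ℂ U) (l : List ℂ) :
    Module.End ℂ U :=
  (l.map fun s => T - algebraMap ℂ (Module.End ℂ U) s).prod

theorem prodSub_cons {U : Type*} [AddCommGroup U] [Module ℂ U] (T : Module.End ℂ U) (s : ℂ)
    (l : List ℂ) (x : U) : prodSub T (s :: l) x = T (prodSub T l x) - s • prodSub T l x := by
  simp [prodSub, Module.algebraMap_end_apply]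

theorem prodSub_intertwine {U V : Type*} [AddCommGroup U] [Module ℂ U] [AddCommGroup V]
    [Module ℂ V] (T : Module.End ℂ U) (T' : Module.End ℂ V) (π : U →ₗ[ℂ] V)
    (h : ∀ x, π (T x) = T' (π x)) (l : List ℂ) (x : U) :
    π (prodSub T l x) = prodSub T' l (π x) := by
  induction l with
  | nil => simp [prodSub]
  | cons s l ih => rw [prodSub_cons, prodSub_cons, map_sub, map_smul, h, ih]

/-- The gains compose multiplicatively because Γ - 1 = (τ - 1) + τ(Γ₁ - 1); the weights in the
weighted triangle inequality are these two summands. -/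
theorem norm_add_sq_le_of_split {τ Γ₁ Γ w N : ℝ} (hτ : 1 < τ) (hΓ₁ : 1 < Γ₁) (hΓ : τ * Γ₁ = Γ)
    (hw : 0 < w) (hwτ : 1 / w ≤ τ - 1) (x y : ℂ) (hy : τ⁻¹ * ‖y‖ ^ 2 ≤ (Γ₁ - 1) * N) :
    ‖x + y‖ ^ 2 ≤ (Γ - 1) * (w * ‖x‖ ^ 2 + N) := by
  have hτ1 : 0 < τ - 1 := by linarith
  have hΓ₁1 : 0 < Γ₁ - 1 := by linarith
  have hτ0 : 0 < τ := by linarith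
  have hsum : 0 < τ * (Γ₁ - 1) := mul_pos hτ0 hΓ₁1
  refine (norm_add_sq_le_weighted x y hsum hτ1).trans ?_
  have e1 : 1 + τ * (Γ₁ - 1) / (τ - 1) = (Γ - 1) / (τ - 1) := by
    rw [← hΓ, eq_div_iff hτ1.ne', add_mul, div_mul_cancel₀ _ hτ1.ne']; ring
  have e2 : 1 + (τ - 1) / (τ * (Γ₁ - 1)) = (Γ - 1) / (τ * (Γ₁ - 1)) := by
    rw [← hΓ, eq_div_iff hsum.ne', add_mul, div_mul_cancel₀ _ hsum.ne']; ring
  have hΓ1 : 0 < Γ - 1 := by nlinarith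
  rw [e1, e2, mul_add, div_mul_eq_mul_div, mul_div_assoc, div_mul_eq_mul_div, mul_div_assoc]
  rw [div_le_iff₀ hw] at hwτ
  refine add_le_add (mul_le_mul_of_nonneg_left ?_ hΓ1.le) (mul_le_mul_of_nonneg_left ?_ hΓ1.le)
  · rw [div_le_iff₀ hτ1]
    nlinarith [mul_le_mul_of_nonneg_right hwτ (sq_nonneg ‖x‖)]
  · rw [div_le_iff₀ hsum]
    rw [inv_mul_le_iff₀ hτ0] at hy
    linarith

/-- For an observable pair `(T, b)` with `T` annihilated by `∏ (T - s)`, `s ∈ l`, the quadratic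
Lyapunov inequality with gain any `Γ > ∏ max 1 |s|²` is solvable. -/
theorem exists_lyapunov_form (l : List ℂ) : ∀ {U : Type*} [AddCommGroup U] [Module ℂ U]
    [FiniteDimensional ℂ U] (T : Module.End ℂ U) (b : U →ₗ[ℂ] ℂ),
    (∀ (s : ℂ) (x : U), T x = s • x → b x = 0 → x = 0) → prodSub T l = 0 →
    ∀ Γ : ℝ, (l.map fun s => max 1 (‖s‖ ^ 2)).prod < Γ →
    ∃ (d : ℕ) (f : Fin d → U →ₗ[ℂ] ℂ), ∀ x : U, x ≠ 0 →
      0 < ∑ j, ‖f j x‖ ^ 2 ∧ ∑ j, ‖f j (T x)‖ ^ 2 < ∑ j, ‖f j x‖ ^ 2 + ‖b x‖ ^ 2 ∧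
      ‖b x‖ ^ 2 ≤ (Γ - 1) * ∑ j, ‖f j x‖ ^ 2 := by
  induction l with
  | nil =>
    intro U _ _ _ T b _ hann Γ _
    refine ⟨0, fun _ => 0, fun x hx => absurd ?_ hx⟩
    have := congrArg (fun A : Module.End ℂ U => A x) hann
    simpa [prodSub] using this
  | cons lam l ih =>
    intro U _ _ _ T b hobs hann Γ hΓ
    rw [List.map_cons, List.prod_cons] at hΓ
    have hp1 := one_le_prod_max l
    have hm1 : 1 ≤ max 1 (‖lam‖ ^ 2) := le_max_left _ _
    by_cases hR : prodSub T l = 0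
    -- The remaining factors already annihilate T, so `lam` is superfluous.
    · exact ih T b hobs hR Γ (by nlinarith)
    -- an eigenvector for `lam`, normalised by `b e = 1`
    have heig : ∀ x, T (prodSub T l x) = lam • prodSub T l x := by
      intro x
      have := congrArg (fun A : Module.End ℂ U => A x) hann
      simpa [prodSub_cons, sub_eq_zero] using this
    obtain ⟨x₀, hx₀⟩ : ∃ x, prodSub T l x ≠ 0 := by
      by_contra hc; push Not at hc; exact hR (LinearMap.ext hc)
    have hb₀ : b (prodSub T l x₀) ≠ 0 := fun h => hx₀ (hobs lam _ (heig x₀) h)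
    set e : U := (b (prodSub T l x₀))⁻¹ • prodSub T l x₀ with he
    have hTe : T e = lam • e := by rw [he, map_smul, heig, smul_comm]
    have hbe : b e = 1 := by rw [he, map_smul, smul_eq_mul, inv_mul_cancel₀ hb₀]
    have hrange : ∀ x, prodSub T l x = b (prodSub T l x) • e := by
      intro x
      rw [← sub_eq_zero]
      apply hobs lam
      · rw [map_sub, map_smul, heig, hTe, smul_sub, smul_comm]
      · rw [map_sub, map_smul, hbe, smul_eq_mul, mul_one, sub_self]
    -- constants
    set p := (l.map fun s => max 1 (‖s‖ ^ 2)).prod with hp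
    obtain ⟨Γ₁, hΓ₁, hΓ₁'⟩ : ∃ Γ₁, p < Γ₁ ∧ Γ₁ < Γ / max 1 (‖lam‖ ^ 2) := by
      apply exists_between
      rw [lt_div_iff₀ (by linarith)]; linarith
    have hΓ₁1 : 1 < Γ₁ := by linarith
    -- The gain is shared out as Γ = τΓ₁: τ pays for `lam`, Γ₁ for the other eigenvalues.
    obtain ⟨τ, hτ⟩ : ∃ τ, τ = Γ / Γ₁ := ⟨_, rfl⟩
    have hτm : max 1 (‖lam‖ ^ 2) < τ := by
      rw [lt_div_iff₀ (by linarith)] at hΓ₁'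
      rw [hτ, lt_div_iff₀ (by linarith)]; linarith
    have hτ1 : 1 < τ := by linarith
    have hτΓ : τ * Γ₁ = Γ := by rw [hτ]; field_simp
    obtain ⟨κ₀, w, r, hw, hr, hwτ, hwl, hsplit⟩ := exists_split_constants lam hτm
    obtain ⟨κ, hκr, hκ0, hunit⟩ := exists_mem_ball_isUnit_sub T lam κ₀ hr
    specialize hsplit κ hκr
    obtain ⟨⟨A, A', _, hA'A⟩, hA⟩ := hunit
    simp only at hA
    -- ψ = κ b (T - (λ - κ))⁻¹ is the coordinate along `e` whose evolution involves only itself and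
    -- the output b. This is why λ - κ must avoid the spectrum.
    obtain ⟨ψ, hψ⟩ : ∃ ψ : U →ₗ[ℂ] ℂ, ψ = κ • (b ∘ₗ A') := ⟨_, rfl⟩
    have hψT : ∀ x, ψ (T x) = (lam - κ) * ψ x + κ * b x := by
      intro x
      have h1 : A' (A x) = x := congrArg (fun A : Module.End ℂ U => A x) hA'A
      rw [hA] at h1
      simp only [LinearMap.sub_apply, Module.algebraMap_end_apply, map_sub, map_smul] at h1
      have h2 : A' (T x) = x + (lam - κ) • A' x := by
        rw [sub_smul, ← sub_eq_iff_eq_add]; exact h1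
      simp only [hψ, LinearMap.smul_apply, LinearMap.comp_apply, h2, map_add, map_smul,
        smul_eq_mul]
      ring
    have hψe : ψ e = 1 := by
      have := hψT e
      rw [hTe, map_smul, hbe, smul_eq_mul] at this
      have h3 : κ * (ψ e - 1) = 0 := by linear_combination this
      rcases mul_eq_zero.mp h3 with h | h
      · exact absurd h hκ0
      · exact sub_eq_zero.mp h
    -- the complement of `e`
    set C := LinearMap.ker ψ
    let π : U →ₗ[ℂ] C := LinearMap.codRestrict C (LinearMap.id - ψ.smulRight e) (by
      intro x; simp [C, hψe])
    have hπ : ∀ x, (π x : U) = x - ψ x • e := fun x => rfl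
    have hπC : ∀ c : C, π c = c := by
      intro c; apply Subtype.ext; rw [hπ, LinearMap.mem_ker.mp c.2]; simp
    have hπe : π e = 0 := by apply Subtype.ext; rw [hπ, hψe]; simp
    -- T₁ is the map induced on U/⟨e⟩, realised on the complement ker ψ. The output there is scaled
    -- by √τ⁻¹, matching the τ⁻¹ in `hsplit`.
    let T₁ : Module.End ℂ C := π ∘ₗ T ∘ₗ C.subtype
    have hT₁ : ∀ c : C, T₁ c = π (T c) := fun c => rfl
    have hint : ∀ x, π (T x) = T₁ (π x) := by
      intro x
      rw [hT₁, hπ, map_sub, map_sub, map_smul, map_smul, hTe, map_smul, hπe]; simp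
    have hann₁ : prodSub T₁ l = 0 := by
      ext c
      rw [← hπC c, ← prodSub_intertwine T T₁ π hint, hrange, map_smul, hπe]; simp
    have hτ0 : 0 < τ := by linarith
    have hθ : 0 < √(τ⁻¹) := Real.sqrt_pos.mpr (inv_pos.mpr hτ0)
    obtain ⟨d, f, hf⟩ := ih (U := C) T₁ (((√(τ⁻¹) : ℝ) : ℂ) • (b ∘ₗ C.subtype)) (by
      -- Observability survives: if c ∈ ker ψ and b c = 0 then ψ(Tc) = 0, so the compression does
      -- nothing to Tc and c is an unobservable eigenvector of T itself.
      intro s c hc hbc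
      have hbc' : b c = 0 := by
        simp only [LinearMap.smul_apply, LinearMap.comp_apply, Submodule.subtype_apply,
          smul_eq_mul, mul_eq_zero] at hbc
        rcases hbc with h | h
        · exact absurd (Complex.ofReal_eq_zero.mp h) hθ.ne'
        · exact h
      apply Subtype.ext
      apply hobs s _ _ hbc'
      have h1 := congrArg Subtype.val hc
      rw [hT₁, hπ, hψT, hbc', LinearMap.mem_ker.mp c.2] at h1
      simpa using h1) hann₁ Γ₁ hΓ₁
    have hθb : ∀ c : C, ‖(((√(τ⁻¹) : ℝ) : ℂ) • (b ∘ₗ C.subtype)) c‖ ^ 2 = τ⁻¹ * ‖b c‖ ^ 2 := by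
      intro c
      simp only [LinearMap.smul_apply, LinearMap.comp_apply, Submodule.subtype_apply,
        smul_eq_mul, norm_mul, Complex.norm_real, mul_pow, Real.norm_eq_abs, sq_abs]
      rw [Real.sq_sqrt (inv_nonneg.mpr hτ0.le)]
    simp only [hθb] at hf
    refine ⟨d + 1, Fin.cons (((√w : ℝ) : ℂ) • ψ) (fun j => f j ∘ₗ π), fun x hx => ?_⟩
    have hN : ∀ y, ∑ j, ‖(Fin.cons (((√w : ℝ) : ℂ) • ψ) (fun j => f j ∘ₗ π) :
        Fin (d + 1) → U →ₗ[ℂ] ℂ) j y‖ ^ 2 = w * ‖ψ y‖ ^ 2 + ∑ j, ‖f j (π y)‖ ^ 2 := by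
      intro y
      rw [Fin.sum_univ_succ]
      simp only [Fin.cons_zero, Fin.cons_succ, LinearMap.smul_apply, LinearMap.comp_apply,
        smul_eq_mul, norm_mul, Complex.norm_real, mul_pow, Real.norm_eq_abs, sq_abs]
      rw [Real.sq_sqrt hw.le]
    rw [hN, hN]
    have hbx : b x = ψ x + b (π x) := by
      rw [hπ, map_sub, map_smul, hbe, smul_eq_mul]; ring
    have hψTx : ψ (T x) = κ * b (π x) + lam * ψ x := by
      rw [hψT, hbx]; ring
    rw [hint, hψTx, hbx]
    have hs := hsplit (ψ x) (b (π x))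
    -- On the line of `e` the inductive form vanishes and is not strict; strictness comes from w|λ|²
    -- < w + 1.
    by_cases hc : π x = 0
    · have hψx : ψ x ≠ 0 := by
        intro h
        apply hx
        have := hπ x
        rw [hc, h] at this
        simpa using this.symm
      have hψpos : 0 < ‖ψ x‖ ^ 2 := by positivity
      rw [hc]
      simp only [map_zero, norm_zero, mul_zero, zero_add, add_zero, norm_mul, mul_pow,
        Submodule.coe_zero]
      simp only [ne_eq, OfNat.ofNat_ne_zero, not_false_eq_true, zero_pow, Finset.sum_const_zero,
        add_zero]
      refine ⟨by positivity, by nlinarith, ?_⟩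
      have : 1 ≤ (Γ - 1) * w := by
        rw [div_le_iff₀ hw] at hwτ
        have : τ ≤ Γ := by nlinarith
        nlinarith
      nlinarith
    · obtain ⟨g1, g2, g3⟩ := hf _ hc
      set N₁ := ∑ j, ‖f j (π x)‖ ^ 2
      refine ⟨by positivity, by linarith, ?_⟩
      exact norm_add_sq_le_of_split hτ1 hΓ₁1 hτΓ hw hwτ _ _ g3

/-! ### From the complex form to a real dual matrix -/

theorem prodSub_eq_aeval {U : Type*} [AddCommGroup U] [Module ℂ U] (T : Module.End ℂ U)
    (l : List ℂ) : prodSub T l = aeval T (l.map fun s => X - C s).prod := by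
  rw [prodSub, map_list_prod, List.map_map]
  congr 1
  apply List.map_congr_left
  intro s _
  simp

open Classical in
theorem prod_max_one_sq (s : Multiset ℂ) :
    (s.map fun x => max 1 (‖x‖ ^ 2)).prod =
      (((s.filter fun x => 1 ≤ ‖x‖).map fun x => ‖x‖).prod) ^ 2 := by
  induction s using Multiset.induction_on with
  | empty => simp
  | cons a s ih =>
    rw [Multiset.map_cons, Multiset.prod_cons, ih]
    by_cases h : 1 ≤ ‖a‖
    · rw [Multiset.filter_cons_of_pos (p := fun x : ℂ => 1 ≤ ‖x‖) _ h, Multiset.map_cons, Multiset.prod_cons, mul_pow,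
        max_eq_right (one_le_pow₀ h)]
    · rw [Multiset.filter_cons_of_neg (p := fun x : ℂ => 1 ≤ ‖x‖) _ h, max_eq_left, one_mul]
      push Not at h
      exact pow_le_one₀ (norm_nonneg _) h.le

theorem one_le_mahlerOf {n : ℕ} (S : Matrix (Fin n) (Fin n) ℝ) : 1 ≤ mahlerOf S := by
  apply Multiset.one_le_prod
  intro x hx
  obtain ⟨y, hy, rfl⟩ := Multiset.mem_map.mp hx
  unfold unstableEigenvalues at hy
  exact (Multiset.mem_filter.mp hy).2

/-- Complexified controllability, in the form that yields the Hautus test: an eigenvector of Sᵀ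
orthogonal to B is orthogonal to every SᵏB. -/
theorem Controllable.eq_zero_of_vecMul {n : ℕ} {S : Matrix (Fin n) (Fin n) ℝ} {B : Fin n → ℝ}
    (h : Controllable S B) (x : Fin n → ℂ)
    (hx : ∀ k : ℕ, x ⬝ᵥ (fun i => (((S ^ k) *ᵥ B) i : ℂ)) = 0) : x = 0 := by
  set K : Matrix (Fin n) (Fin n) ℝ :=
    Matrix.of fun (a j : Fin n) => ((S ^ (j : ℕ)) *ᵥ B) a with hK
  have hrank : K.rank = n := h
  have hsurj : Function.Surjective K.mulVec := by
    have : LinearMap.range K.mulVecLin = ⊤ := by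
      apply Submodule.eq_top_of_finrank_eq
      rw [← Matrix.rank, hrank]; simp
    exact LinearMap.range_eq_top.mp this
  have hU : IsUnit K := Matrix.mulVec_surjective_iff_isUnit.mp hsurj
  have hdet : (K.map (algebraMap ℝ ℂ))ᵀ.det ≠ 0 := by
    rw [Matrix.det_transpose]
    have := RingHom.map_det (algebraMap ℝ ℂ) K
    rw [RingHom.mapMatrix_apply] at this
    rw [← this]
    simpa using ((Matrix.isUnit_iff_isUnit_det K).mp hU).ne_zero
  apply Matrix.eq_zero_of_mulVec_eq_zero hdet
  ext j
  rw [Matrix.mulVec_transpose, Matrix.vecMul]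
  exact hx j

/-- On real vectors, |f x|² is the sum of the squares of two real functionals, the real and
imaginary parts of f. -/
theorem exists_matrix_of_functionals {n d : ℕ} (f : Fin d → (Fin n → ℂ) →ₗ[ℂ] ℂ) :
    ∃ W : Matrix (Fin n) (Fin n) ℝ, W.IsHermitian ∧ ∀ x : Fin n → ℝ,
      x ⬝ᵥ (W *ᵥ x) = ∑ j, ‖f j (fun i => (x i : ℂ))‖ ^ 2 := by
  let R : Matrix (Fin d) (Fin n) ℝ := Matrix.of fun j i => (f j (Pi.single i 1)).re
  let J : Matrix (Fin d) (Fin n) ℝ := Matrix.of fun j i => (f j (Pi.single i 1)).im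
  refine ⟨Rᵀ * R + Jᵀ * J, ?_, fun x => ?_⟩
  · rw [Matrix.IsHermitian, Matrix.conjTranspose_eq_transpose_of_trivial]
    simp [Matrix.transpose_mul]
  · have hf : ∀ j, f j (fun i => (x i : ℂ)) = ∑ i, (x i : ℂ) * f j (Pi.single i 1) := by
      intro j
      rw [(f j).pi_apply_eq_sum_univ]
      refine Finset.sum_congr rfl fun i _ => ?_
      rw [smul_eq_mul]
      congr 2
      ext k
      simp [Pi.single_apply, eq_comm]
    have hq : ∀ Q : Matrix (Fin d) (Fin n) ℝ, x ⬝ᵥ ((Qᵀ * Q) *ᵥ x) = ∑ j, (Q *ᵥ x) j ^ 2 := by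
      intro Q
      rw [← Matrix.mulVec_mulVec, Matrix.mulVec_transpose, dotProduct_comm,
        ← Matrix.dotProduct_mulVec, dotProduct]
      simp [sq]
    rw [Matrix.add_mulVec, dotProduct_add, hq, hq, ← Finset.sum_add_distrib]
    refine Finset.sum_congr rfl fun j _ => ?_
    rw [Complex.sq_norm, Complex.normSq_apply, hf]
    simp only [Complex.re_sum, Complex.im_sum, Complex.re_ofReal_mul, Complex.im_ofReal_mul]
    simp only [Matrix.mulVec, dotProduct, R, J, Matrix.of_apply, sq, mul_comm]

/-- Dual (Lyapunov-type) form of the modified Riccati inequality. -/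
theorem exists_dual_solution {n : ℕ} {S : Matrix (Fin n) (Fin n) ℝ} {B : Fin n → ℝ}
    (hSB : Controllable S B) {Γ : ℝ} (hΓ : mahlerOf S ^ 2 < Γ) :
    ∃ W : Matrix (Fin n) (Fin n) ℝ, W.IsHermitian ∧ ∀ x : Fin n → ℝ, x ≠ 0 →
      0 < x ⬝ᵥ (W *ᵥ x) ∧
      (Sᵀ *ᵥ x) ⬝ᵥ (W *ᵥ (Sᵀ *ᵥ x)) < x ⬝ᵥ (W *ᵥ x) + (x ⬝ᵥ B) ^ 2 ∧
      (x ⬝ᵥ B) ^ 2 ≤ (Γ - 1) * (x ⬝ᵥ (W *ᵥ x)) := by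
  set Sc := S.map (algebraMap ℝ ℂ) with hSc
  let T : Module.End ℂ (Fin n → ℂ) := Matrix.toLin' Scᵀ
  let b : (Fin n → ℂ) →ₗ[ℂ] ℂ :=
    (LinearMap.proj 0) ∘ₗ (Matrix.mulVecLin (Matrix.of fun (_ : Fin 1) i => (B i : ℂ)))
  have hb : ∀ x, b x = x ⬝ᵥ (fun i => (B i : ℂ)) := by
    intro x
    simp [b, Matrix.mulVec, dotProduct, mul_comm]
  have hTx : ∀ x, T x = x ᵥ* Sc := fun x => by simp [T, Matrix.mulVec_transpose]
  have hobs : ∀ (s : ℂ) (x : Fin n → ℂ), T x = s • x → b x = 0 → x = 0 := by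
    intro s x hx hbx
    apply hSB.eq_zero_of_vecMul
    intro k
    have hpow : x ᵥ* (Sc ^ k) = s ^ k • x := by
      induction k with
      | zero => simp
      | succ k ih =>
        rw [pow_succ, ← Matrix.vecMul_vecMul, ih, Matrix.smul_vecMul, ← hTx, hx, smul_smul,
          pow_succ]
    have hmap : (fun i => (((S ^ k) *ᵥ B) i : ℂ)) = (Sc ^ k) *ᵥ (fun i => (B i : ℂ)) := by
      have h1 : Sc ^ k = (S ^ k).map (algebraMap ℝ ℂ) := by
        rw [hSc, ← RingHom.mapMatrix_apply, ← RingHom.mapMatrix_apply, map_pow]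
      ext i
      rw [h1]
      simp [Matrix.mulVec, dotProduct]
    rw [hmap, Matrix.dotProduct_mulVec, hpow, smul_dotProduct, ← hb, hbx, smul_zero]
  -- Cayley-Hamilton for Sᵀ, whose characteristic polynomial is that of S.
  have hann : prodSub T (complexEigenvalues S).toList = 0 := by
    rw [prodSub_eq_aeval, ← Multiset.prod_coe, ← Multiset.map_coe, Multiset.coe_toList,
      complexEigenvalues, ← (IsAlgClosed.splits _).eq_prod_roots_of_monic
        (Matrix.charpoly_monic _), ← Matrix.charpoly_transpose]
    have h1 := Matrix.aeval_self_charpoly Scᵀ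
    have h2 : aeval T Scᵀ.charpoly =
        Matrix.toLinAlgEquiv' (aeval Scᵀ Scᵀ.charpoly) := by
      rw [← AlgEquiv.coe_toAlgHom, ← Polynomial.aeval_algHom_apply]; rfl
    rw [h2, h1, map_zero]
  obtain ⟨d, f, hf⟩ := exists_lyapunov_form (complexEigenvalues S).toList T b hobs hann Γ (by
    rw [← Multiset.prod_coe, ← Multiset.map_coe, Multiset.coe_toList, prod_max_one_sq]
    exact hΓ)
  obtain ⟨W, hW, hWf⟩ := exists_matrix_of_functionals f
  refine ⟨W, hW, fun x hx => ?_⟩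
  have hx' : (fun i => (x i : ℂ)) ≠ 0 := by
    intro h
    apply hx
    ext i
    have := congrFun h i
    simpa using this
  have hT : T (fun i => (x i : ℂ)) = fun i => ((Sᵀ *ᵥ x) i : ℂ) := by
    ext i
    simp [T, hSc, Matrix.mulVec, dotProduct]
  have hbx : ‖b (fun i => (x i : ℂ))‖ ^ 2 = (x ⬝ᵥ B) ^ 2 := by
    have : b (fun i => (x i : ℂ)) = ((x ⬝ᵥ B : ℝ) : ℂ) := by
      rw [hb]; simp [dotProduct]
    rw [this, Complex.norm_real, Real.norm_eq_abs, sq_abs]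
  have := hf _ hx'
  rw [hT, hbx, ← hWf, ← hWf] at this
  exact this

/-! ### Solving the modified Riccati inequality by inversion -/

theorem dotProduct_mulVec_comm {n : ℕ} {P : Matrix (Fin n) (Fin n) ℝ} (hP : Pᵀ = P)
    (x y : Fin n → ℝ) : x ⬝ᵥ (P *ᵥ y) = y ⬝ᵥ (P *ᵥ x) := by
  rw [Matrix.dotProduct_mulVec, ← Matrix.mulVec_transpose, hP, dotProduct_comm]

/-- The quadratic form of the Riccati residual. -/
theorem dotProduct_riccati {n : ℕ} (S P : Matrix (Fin n) (Fin n) ℝ) (B x : Fin n → ℝ) (c : ℝ)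
    (hP : Pᵀ = P) :
    x ⬝ᵥ ((P - Sᵀ * P * S + c • Matrix.vecMulVec ((Sᵀ * P) *ᵥ B) (B ᵥ* (P * S))) *ᵥ x) =
      x ⬝ᵥ (P *ᵥ x) - (S *ᵥ x) ⬝ᵥ (P *ᵥ (S *ᵥ x)) + c * (B ⬝ᵥ (P *ᵥ (S *ᵥ x))) ^ 2 := by
  have h1 : x ⬝ᵥ ((Sᵀ * P * S) *ᵥ x) = (S *ᵥ x) ⬝ᵥ (P *ᵥ (S *ᵥ x)) := by
    rw [← Matrix.mulVec_mulVec, ← Matrix.mulVec_mulVec, Matrix.mulVec_transpose,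
      dotProduct_comm, ← Matrix.dotProduct_mulVec, dotProduct_comm]
  have h2 : (B ᵥ* (P * S)) ⬝ᵥ x = B ⬝ᵥ (P *ᵥ (S *ᵥ x)) := by
    rw [← Matrix.dotProduct_mulVec, Matrix.mulVec_mulVec]
  have h3 : x ⬝ᵥ ((Sᵀ * P) *ᵥ B) = B ⬝ᵥ (P *ᵥ (S *ᵥ x)) := by
    rw [← Matrix.mulVec_mulVec, Matrix.mulVec_transpose, dotProduct_comm,
      ← Matrix.dotProduct_mulVec, dotProduct_comm, dotProduct_mulVec_comm hP]
  rw [Matrix.add_mulVec, Matrix.sub_mulVec, dotProduct_add, dotProduct_sub, h1,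
    Matrix.smul_mulVec, dotProduct_smul, Matrix.vecMulVec_mulVec, h2]
  rw [smul_eq_mul, op_smul_eq_smul, dotProduct_smul, h3, smul_eq_mul]
  ring

theorem riccati_isHermitian {n : ℕ} (S P : Matrix (Fin n) (Fin n) ℝ) (B : Fin n → ℝ) (c : ℝ)
    (hP : Pᵀ = P) :
    (P - Sᵀ * P * S +
      c • Matrix.vecMulVec ((Sᵀ * P) *ᵥ B) (B ᵥ* (P * S))).IsHermitian := by
  have h : B ᵥ* (P * S) = (Sᵀ * P) *ᵥ B := by
    rw [← Matrix.mulVec_transpose, Matrix.transpose_mul, hP]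
  rw [Matrix.IsHermitian, Matrix.conjTranspose_eq_transpose_of_trivial, h]
  simp only [Matrix.transpose_add, Matrix.transpose_sub, Matrix.transpose_mul,
    Matrix.transpose_smul, Matrix.transpose_transpose, hP, Matrix.transpose_vecMulVec,
    Matrix.mul_assoc]

/-- Inverting a dual solution gives a solution of the modified Riccati inequality. -/
theorem solvesRiccati_inv {n : ℕ} {S W : Matrix (Fin n) (Fin n) ℝ} {B : Fin n → ℝ}
    (hB : B ≠ 0) {ζ : ℝ} (hζ : 0 < ζ) (hW : W.IsHermitian)
    (hpos : ∀ x : Fin n → ℝ, x ≠ 0 →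
      0 < x ⬝ᵥ (W *ᵥ x) ∧
      (Sᵀ *ᵥ x) ⬝ᵥ (W *ᵥ (Sᵀ *ᵥ x)) < x ⬝ᵥ (W *ᵥ x) + (x ⬝ᵥ B) ^ 2 ∧
      (x ⬝ᵥ B) ^ 2 ≤ ((ζ ^ 2)⁻¹ - 1) * (x ⬝ᵥ (W *ᵥ x))) :
    SolvesRiccati S B ζ W⁻¹ := by
  have hWpd : W.PosDef := Matrix.PosDef.of_dotProduct_mulVec_pos hW fun x hx => by
    simpa using (hpos x hx).1
  have hPpd : W⁻¹.PosDef := hWpd.inv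
  have hWt : Wᵀ = W := by rw [← Matrix.conjTranspose_eq_transpose_of_trivial]; exact hW
  set P := W⁻¹ with hPd
  have hPt : Pᵀ = P := by
    rw [← Matrix.conjTranspose_eq_transpose_of_trivial]; exact hPpd.isHermitian
  have hWP : ∀ x, W *ᵥ (P *ᵥ x) = x := fun x => by
    rw [Matrix.mulVec_mulVec, hPd, Matrix.mul_nonsing_inv _ (hWpd.det_pos.ne'.isUnit),
      Matrix.one_mulVec]
  have hPW : ∀ x, P *ᵥ (W *ᵥ x) = x := fun x => by
    rw [Matrix.mulVec_mulVec, hPd, Matrix.nonsing_inv_mul _ (hWpd.det_pos.ne'.isUnit),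
      Matrix.one_mulVec]
  have hPpos : ∀ x, x ≠ 0 → 0 < x ⬝ᵥ (P *ᵥ x) := fun x hx => by
    simpa using hPpd.dotProduct_mulVec_pos hx
  set β := B ⬝ᵥ (P *ᵥ B) with hβ
  have hβ0 : 0 < β := hPpos B hB
  have hPB : P *ᵥ B ≠ 0 := by
    intro h; rw [h] at hβ; simp at hβ; exact hβ0.ne' hβ
  -- The third inequality of `hpos`, tested at PB.
  have hβ1 : β ≤ (ζ ^ 2)⁻¹ - 1 := by
    have := (hpos _ hPB).2.2
    rw [hWP, dotProduct_comm, ← hβ, sq] at this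
    exact le_of_mul_le_mul_right this hβ0
  refine ⟨hPpd, Matrix.PosDef.of_dotProduct_mulVec_pos (riccati_isHermitian S P B _ hPt)
    fun x hx => ?_⟩
  rw [star_trivial, dotProduct_riccati S P B x _ hPt]
  set w := S *ᵥ x with hw
  have hx0 := hPpos x hx
  set g := w ⬝ᵥ (P *ᵥ w) - (B ⬝ᵥ (P *ᵥ w)) ^ 2 / (1 + β) with hg
  -- The Sherman-Morrison coefficient 1/(1+β) is at most the Riccati coefficient; this is where β ≤
  -- ζ⁻² - 1 is needed.
  have hk : (1 + β)⁻¹ ≤ (1 - ζ ^ 2) / β := by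
    rw [inv_le_iff_one_le_mul₀ (by linarith), div_mul_eq_mul_div, le_div_iff₀ hβ0]
    have : ζ ^ 2 * (1 + β) ≤ 1 := by
      have h2 : 1 + β ≤ (ζ ^ 2)⁻¹ := by linarith
      calc ζ ^ 2 * (1 + β) ≤ ζ ^ 2 * (ζ ^ 2)⁻¹ := by gcongr
        _ = 1 := by field_simp
    linarith
  suffices hgx : g < x ⬝ᵥ (P *ᵥ x) by
    have h3 : (1 + β)⁻¹ * (B ⬝ᵥ (P *ᵥ w)) ^ 2 ≤ (1 - ζ ^ 2) / β * (B ⬝ᵥ (P *ᵥ w)) ^ 2 := by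
      gcongr
    have h4 : g = w ⬝ᵥ (P *ᵥ w) - (1 + β)⁻¹ * (B ⬝ᵥ (P *ᵥ w)) ^ 2 := by
      rw [hg, div_eq_inv_mul]
    linarith
  set c := (B ⬝ᵥ (P *ᵥ w)) / (1 + β) with hc
  -- p = (W + BBᵀ)⁻¹w by Sherman-Morrison, so that g = pᵀ(W + BBᵀ)p.
  set p := P *ᵥ w - c • (P *ᵥ B) with hp
  have hpB : p ⬝ᵥ B = c := by
    rw [hp, sub_dotProduct, smul_dotProduct, dotProduct_comm _ B, dotProduct_comm _ B, ← hβ,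
      smul_eq_mul, hc]
    field_simp
    ring
  have hWp : W *ᵥ p = w - c • B := by
    rw [hp, Matrix.mulVec_sub, Matrix.mulVec_smul, hWP, hWP]
  have hpw : p ⬝ᵥ w = g := by
    rw [hp, sub_dotProduct, smul_dotProduct, dotProduct_comm _ w, dotProduct_comm _ w,
      dotProduct_mulVec_comm hPt w B, hg, smul_eq_mul, hc]
    field_simp
  have hgp : p ⬝ᵥ (W *ᵥ p) + (p ⬝ᵥ B) ^ 2 = g := by
    rw [hWp, dotProduct_sub, hpw, dotProduct_smul, hpB, smul_eq_mul]; ring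
  by_cases hp0 : p = 0
  · rw [← hpw, hp0, zero_dotProduct]; exact hx0
  have hSp := (hpos p hp0).2.1
  rw [hgp] at hSp
  set s := Sᵀ *ᵥ p with hs
  have hsx : s ⬝ᵥ x = g := by
    rw [hs, Matrix.mulVec_transpose, ← Matrix.dotProduct_mulVec, ← hw, hpw]
  have hg0 : 0 < g := by
    have : 0 < p ⬝ᵥ (W *ᵥ p) := (hpos p hp0).1
    rw [← hgp]; positivity
  -- Cauchy-Schwarz between W and its inverse: g² = (s·x)² ≤ (sᵀWs)(xᵀPx). Since sᵀWs < g, dividing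
  -- by g gives the claim.
  have hcs : 0 ≤ s ⬝ᵥ (W *ᵥ s) - g ^ 2 / (x ⬝ᵥ (P *ᵥ x)) := by
    set t := g / (x ⬝ᵥ (P *ᵥ x)) with ht
    have h0 : 0 ≤ (s - t • (P *ᵥ x)) ⬝ᵥ (W *ᵥ (s - t • (P *ᵥ x))) := by
      simpa using hWpd.posSemidef.dotProduct_mulVec_nonneg (s - t • (P *ᵥ x))
    have h1 : (P *ᵥ x) ⬝ᵥ (W *ᵥ s) = s ⬝ᵥ x := by
      rw [dotProduct_mulVec_comm hWt, hWP]
    rw [Matrix.mulVec_sub, Matrix.mulVec_smul, hWP, sub_dotProduct, dotProduct_sub,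
      dotProduct_sub, smul_dotProduct, smul_dotProduct, dotProduct_smul, dotProduct_smul, h1,
      hsx, dotProduct_comm (P *ᵥ x) x] at h0
    simp only [smul_eq_mul] at h0
    have h5 : t * (x ⬝ᵥ (P *ᵥ x)) = g := by rw [ht, div_mul_cancel₀ _ hx0.ne']
    have h6 : g ^ 2 / (x ⬝ᵥ (P *ᵥ x)) = t * g := by rw [ht]; ring
    rw [h5] at h0
    rw [h6]; linarith
  have h7 : g ^ 2 / (x ⬝ᵥ (P *ᵥ x)) < g := by linarith
  rw [div_lt_iff₀ hx0, sq] at h7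
  exact lt_of_mul_lt_mul_left h7 hg0.le

theorem Controllable.ne_zero {n : ℕ} {S : Matrix (Fin n) (Fin n) ℝ} {B : Fin n → ℝ}
    (h : Controllable S B) (hn : n ≠ 0) : B ≠ 0 := by
  rintro rfl
  have := h.eq_zero_of_vecMul (fun _ => 1) (fun k => by simp [dotProduct])
  have := congrFun this ⟨0, Nat.pos_of_ne_zero hn⟩
  simp at this

theorem exists_solvesRiccati {n : ℕ} {S : Matrix (Fin n) (Fin n) ℝ} {B : Fin n → ℝ}
    (hSB : Controllable S B) (hn : n ≠ 0) {ζ : ℝ} (hζ : 0 < ζ) (hM : mahlerOf S < ζ⁻¹) :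
    ∃ P, SolvesRiccati S B ζ P := by
  have hΓ : mahlerOf S ^ 2 < (ζ ^ 2)⁻¹ := by
    rw [← inv_pow]
    exact pow_lt_pow_left₀ hM (by linarith [one_le_mahlerOf S]) two_ne_zero
  obtain ⟨W, hW, h⟩ := exists_dual_solution hSB hΓ
  exact ⟨W⁻¹, solvesRiccati_inv (hSB.ne_zero hn) hζ hW h⟩

/-! ### The event trigger and the held estimate -/

section Trigger

variable {n : ℕ} {S : Matrix (Fin n) (Fin n) ℝ} {c₀ c₁ rho : ℝ} {x xhat : ℕ → Fin n → ℝ}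

/-- Finite triggering instants increase strictly, so their intervals cover ℕ; an infinite next
instant makes the current interval a half-line. -/
theorem exists_trigger_interval (k : ℕ) :
    ∃ s t : ℕ, triggerTime S c₀ c₁ rho x s = (t : ℕ∞) ∧ t ≤ k ∧
      (k : ℕ∞) < triggerTime S c₀ c₁ rho x (s + 1) := by
  have hstep : ∀ s t : ℕ, triggerTime S c₀ c₁ rho x s = (t : ℕ∞) →
      ((t + 1 : ℕ) : ℕ∞) ≤ triggerTime S c₀ c₁ rho x (s + 1) := by
    intro s t hst
    rw [triggerTime]
    apply le_sInf
    rintro _ ⟨j, rfl, hj, _⟩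
    rw [hst] at hj
    exact_mod_cast Nat.succ_le_of_lt (by exact_mod_cast hj)
  induction k with
  | zero => exact ⟨0, 0, rfl, le_rfl, lt_of_lt_of_le (by simp) (hstep 0 0 rfl)⟩
  | succ k ih =>
    obtain ⟨s, t, hst, htk, hk⟩ := ih
    by_cases h : ((k + 1 : ℕ) : ℕ∞) < triggerTime S c₀ c₁ rho x (s + 1)
    · exact ⟨s, t, hst, by omega, h⟩
    · have hle : ((k + 1 : ℕ) : ℕ∞) ≤ triggerTime S c₀ c₁ rho x (s + 1) := by
        push_cast; exact Order.add_one_le_of_lt hk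
      have heq : triggerTime S c₀ c₁ rho x (s + 1) = ((k + 1 : ℕ) : ℕ∞) :=
        le_antisymm (not_lt.mp h) hle
      refine ⟨s + 1, k + 1, heq, le_rfl, lt_of_lt_of_le ?_ (hstep _ _ heq)⟩
      exact_mod_cast Nat.lt_succ_self _

theorem IsHeldEstimate.zero (h : IsHeldEstimate S c₀ c₁ rho x xhat) : xhat 0 = x 0 := by
  obtain ⟨s, t, hst, htk, hk⟩ := exists_trigger_interval (S := S) (c₀ := c₀) (c₁ := c₁)
    (rho := rho) (x := x) 0
  obtain rfl : t = 0 := by omega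
  rw [h s 0 0 hst le_rfl hk]
  simp

open Classical in
/-- The recursion satisfied by the held estimate. -/
theorem IsHeldEstimate.succ (h : IsHeldEstimate S c₀ c₁ rho x xhat) (k : ℕ) :
    xhat (k + 1) = if c₀ + c₁ * rho ^ (k + 1) ≤ ‖WithLp.toLp 2 (S *ᵥ xhat k - x (k + 1))‖ ^ 2
      then x (k + 1) else S *ᵥ xhat k := by
  obtain ⟨s, t, hst, htk, hk⟩ := exists_trigger_interval (S := S) (c₀ := c₀) (c₁ := c₁)
    (rho := rho) (x := x) k
  have hpow : (S ^ (k + 1 - t)) *ᵥ x t = S *ᵥ xhat k := by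
    rw [h s t k hst htk hk, Matrix.mulVec_mulVec, ← pow_succ']
    congr 2; omega
  have htrig : triggerFun S c₀ c₁ rho x t (k + 1) =
      ‖WithLp.toLp 2 (S *ᵥ xhat k - x (k + 1))‖ ^ 2 - (c₀ + c₁ * rho ^ (k + 1)) := by
    rw [triggerFun, hpow]
  by_cases hlt : ((k + 1 : ℕ) : ℕ∞) < triggerTime S c₀ c₁ rho x (s + 1)
  · rw [if_neg, h s t (k + 1) hst (by omega) hlt, hpow]
    intro hge
    apply absurd hlt
    rw [not_lt, triggerTime]
    apply sInf_le
    refine ⟨k + 1, rfl, ?_, ?_⟩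
    · rw [hst]; exact_mod_cast Nat.lt_succ_of_le htk
    · rw [hst, ENat.toNat_natCast, htrig]; linarith
  · have hle : ((k + 1 : ℕ) : ℕ∞) ≤ triggerTime S c₀ c₁ rho x (s + 1) := by
      push_cast; exact Order.add_one_le_of_lt hk
    have heq : triggerTime S c₀ c₁ rho x (s + 1) = ((k + 1 : ℕ) : ℕ∞) :=
      le_antisymm (not_lt.mp hlt) hle
    obtain ⟨s', t', hst', htk', hk'⟩ := exists_trigger_interval (S := S) (c₀ := c₀) (c₁ := c₁)
      (rho := rho) (x := x) (k + 1)
    have hmem : triggerTime S c₀ c₁ rho x (s + 1) ∈ {t : ℕ∞ | ∃ k : ℕ, t = (k : ℕ∞) ∧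
        triggerTime S c₀ c₁ rho x s < (k : ℕ∞) ∧
        0 ≤ triggerFun S c₀ c₁ rho x (triggerTime S c₀ c₁ rho x s).toNat k} := by
      rw [triggerTime]
      -- The next instant is finite, so the set is nonempty and, by well-ordering, its infimum
      -- satisfies the trigger condition.
      apply csInf_mem
      by_contra hne
      rw [Set.not_nonempty_iff_eq_empty] at hne
      rw [triggerTime, hne, sInf_empty] at heq
      exact absurd heq (ENat.natCast_ne_top _).symm
    obtain ⟨j, hj, _, hj2⟩ := hmem
    rw [heq] at hj
    obtain rfl : k + 1 = j := by exact_mod_cast hj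
    rw [hst, ENat.toNat_natCast, htrig] at hj2
    rw [if_pos (by linarith)]
    have hnext : ((k + 1 : ℕ) : ℕ∞) < triggerTime S c₀ c₁ rho x (s + 1 + 1) := by
      have h3 : ((k + 1 + 1 : ℕ) : ℕ∞) ≤ triggerTime S c₀ c₁ rho x (s + 1 + 1) := by
        rw [triggerTime]
        apply le_sInf
        rintro _ ⟨j, rfl, hj, _⟩
        rw [heq] at hj
        exact_mod_cast Nat.succ_le_of_lt (by exact_mod_cast hj)
      exact lt_of_lt_of_le (by exact_mod_cast Nat.lt_succ_self _) h3
    rw [h (s + 1) (k + 1) (k + 1) heq le_rfl hnext]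
    simp

/-- At an event the error is reset to zero; otherwise the trigger condition fails, so the error is
below a threshold that never exceeds c₀ + c₁. -/
theorem IsHeldEstimate.norm_sub_sq_le (h : IsHeldEstimate S c₀ c₁ rho x xhat)
    (hc₀ : 0 < c₀) (hc₁ : 0 < c₁) (hrho : rho ∈ Set.Ioo (0 : ℝ) 1) (k : ℕ) :
    ‖WithLp.toLp 2 (xhat k - x k)‖ ^ 2 ≤ c₀ + c₁ := by
  cases k with
  | zero => rw [h.zero]; simp; linarith
  | succ k =>
    rw [h.succ k]
    split_ifs with hif
    · simp; linarith
    · push Not at hif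
      have : rho ^ (k + 1) ≤ 1 := pow_le_one₀ hrho.1.le hrho.2.le
      nlinarith

theorem aestronglyMeasurable_heldEstimate {Ω : Type*} [MeasurableSpace Ω] {ν : Measure Ω}
    {x xhat : ℕ → Ω → Fin n → ℝ}
    (h : ∀ ω, IsHeldEstimate S c₀ c₁ rho (fun k => x k ω) (fun k => xhat k ω)) (k : ℕ)
    (hx : AEStronglyMeasurable (x (k + 1)) ν) (hxhat : AEStronglyMeasurable (xhat k) ν) :
    AEStronglyMeasurable (xhat (k + 1)) ν := by
  classical
  let G : (Fin n → ℝ) × (Fin n → ℝ) → (Fin n → ℝ) := fun p =>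
    if c₀ + c₁ * rho ^ (k + 1) ≤ ‖WithLp.toLp 2 (S *ᵥ p.1 - p.2)‖ ^ 2 then p.2 else S *ᵥ p.1
  have hG : Measurable G := by
    have hcont : Continuous fun p : (Fin n → ℝ) × (Fin n → ℝ) =>
        ‖WithLp.toLp 2 (S *ᵥ p.1 - p.2)‖ ^ 2 := by
      have h1 : Continuous fun p : (Fin n → ℝ) × (Fin n → ℝ) => S *ᵥ p.1 - p.2 :=
        (Continuous.matrix_mulVec continuous_const continuous_fst).sub continuous_snd
      exact ((PiLp.continuous_toLp 2 _).comp h1).norm.pow 2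
    apply Measurable.ite
    · exact (isClosed_le continuous_const hcont).measurableSet
    · exact measurable_snd
    · exact (Continuous.matrix_mulVec continuous_const continuous_fst).measurable
  have heq : xhat (k + 1) = fun ω => G (xhat k ω, x (k + 1) ω) := by
    ext1 ω
    exact (h ω).succ k
  rw [heq]
  exact (hG.comp_aemeasurable (hxhat.aemeasurable.prodMk hx.aemeasurable)).aestronglyMeasurable

end Trigger

/-! ### Spectral contraction by the Laplacian -/

section Graph

variable {m : ℕ} {a : Matrix (Fin m) (Fin m) ℝ}

theorem laplacian_mulVec (a : Matrix (Fin m) (Fin m) ℝ) (x : Fin m → ℝ) (i : Fin m) :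
    (laplacian a *ᵥ x) i = ∑ j, a i j * (x i - x j) := by
  rw [laplacian, Matrix.sub_mulVec, Pi.sub_apply, Matrix.mulVec_diagonal, Finset.sum_mul,
    Matrix.mulVec, dotProduct, ← Finset.sum_sub_distrib]
  simp [mul_sub]

theorem laplacian_posSemidef (ha : a.IsSymm) (ha0 : ∀ i j, 0 ≤ a i j) :
    (laplacian a).PosSemidef := by
  refine Matrix.PosSemidef.of_dotProduct_mulVec_nonneg (laplacian_isHermitian ha) fun x => ?_
  rw [star_trivial]
  have h1 : x ⬝ᵥ (laplacian a *ᵥ x) = ∑ i, ∑ j, a i j * (x i * (x i - x j)) := by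
    simp only [dotProduct, laplacian_mulVec, Finset.mul_sum]
    exact Finset.sum_congr rfl fun i _ => Finset.sum_congr rfl fun j _ => by ring
  have h2 : x ⬝ᵥ (laplacian a *ᵥ x) = ∑ i, ∑ j, a i j * (x j * (x j - x i)) := by
    rw [h1, Finset.sum_comm]
    refine Finset.sum_congr rfl fun i _ => Finset.sum_congr rfl fun j _ => ?_
    rw [ha.apply]
  have h3 : 2 * (x ⬝ᵥ (laplacian a *ᵥ x)) = ∑ i, ∑ j, a i j * (x i - x j) ^ 2 := by
    rw [two_mul]
    nth_rewrite 1 [h1]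
    rw [h2, ← Finset.sum_add_distrib]
    refine Finset.sum_congr rfl fun i _ => ?_
    rw [← Finset.sum_add_distrib]
    exact Finset.sum_congr rfl fun j _ => by ring
  have h4 : 0 ≤ ∑ i, ∑ j, a i j * (x i - x j) ^ 2 :=
    Finset.sum_nonneg fun i _ => Finset.sum_nonneg fun j _ => mul_nonneg (ha0 i j) (sq_nonneg _)
  linarith

/-- The spectral form of consensus contraction: on vectors with zero sum, `1 - g L` has norm at
most `z` as soon as `|1 - g μ| ≤ z` on `[μ₂, μₘ]`. -/
theorem sum_sq_sub_laplacian_le (ha : a.IsSymm) (hm : 2 ≤ m) (hmu : mu2 ha hm ≠ 0) {g z : ℝ}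
    (hg : ∀ t, mu2 ha hm ≤ t → t ≤ muMax ha hm → (1 - g * t) ^ 2 ≤ z ^ 2)
    (hmu0 : 0 ≤ mu2 ha hm) (κ : Fin m → ℝ) (hκ : ∑ i, κ i = 0) :
    ∑ i, (κ i - g * (laplacian a *ᵥ κ) i) ^ 2 ≤ z ^ 2 * ∑ i, κ i ^ 2 := by
  set hL := laplacian_isHermitian ha
  set v := hL.eigenvectorBasis with hv
  have hLv : ∀ j, laplacian a *ᵥ (v j).ofLp = hL.eigenvalues j • (v j).ofLp := fun j =>
    hL.mulVec_eigenvectorBasis j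
  have hinner : ∀ (j : Fin m) (y : Fin m → ℝ),
      inner ℝ (v j) (WithLp.toLp 2 y) = (v j).ofLp ⬝ᵥ y := by
    intro j y
    simp [PiLp.inner_apply, dotProduct, mul_comm]
  have hsum : ∀ y : Fin m → ℝ, ∑ i, y i ^ 2 = ∑ j, ((v j).ofLp ⬝ᵥ y) ^ 2 := by
    intro y
    have h1 := v.sum_sq_norm_inner_right (WithLp.toLp 2 y)
    rw [EuclideanSpace.norm_sq_eq] at h1
    simp only [hinner, Real.norm_eq_abs, sq_abs] at h1
    exact h1.symm
  have hLt : (laplacian a)ᵀ = laplacian a := by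
    rw [← Matrix.conjTranspose_eq_transpose_of_trivial]; exact hL
  have hcoef : ∀ (j : Fin m) (y : Fin m → ℝ), (v j).ofLp ⬝ᵥ (laplacian a *ᵥ y) =
      hL.eigenvalues j * ((v j).ofLp ⬝ᵥ y) := by
    intro j y
    rw [dotProduct_mulVec_comm hLt, hLv, dotProduct_smul, dotProduct_comm, smul_eq_mul]
  -- eigenvalue location
  let e : Fin m ≃ Fin (Fintype.card (Fin m)) :=
    (Fintype.equivOfCardEq (Fintype.card_fin (Fintype.card (Fin m)))).symm
  have heig : ∀ j, hL.eigenvalues j = hL.eigenvalues₀ (e j) := fun j => rfl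
  have hanti := hL.eigenvalues₀_antitone
  have hloc : ∀ j, (e j : ℕ) ≠ m - 1 →
      mu2 ha hm ≤ hL.eigenvalues j ∧ hL.eigenvalues j ≤ muMax ha hm := by
    intro j hj
    have hlt : (e j : ℕ) < m := by simpa using (e j).2
    rw [heig]
    constructor
    · apply hanti
      rw [Fin.le_def]
      simp [Fin.rev]
      omega
    · apply hanti
      rw [Fin.le_def]
      simp [Fin.rev]
      omega
  have hone : laplacian a *ᵥ (fun _ => (1 : ℝ)) = 0 := by
    ext i; rw [laplacian_mulVec]; simp
  have horth : ∀ j, (e j : ℕ) ≠ m - 1 → (v j).ofLp ⬝ᵥ (fun _ => (1 : ℝ)) = 0 := by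
    intro j hj
    have h1 := hcoef j (fun _ => 1)
    rw [hone, dotProduct_zero] at h1
    rcases mul_eq_zero.mp h1.symm with h | h
    · have := (hloc j hj).1
      exact absurd (le_antisymm (by linarith) hmu0) hmu
    · exact h
  have hker : ∀ j, (e j : ℕ) = m - 1 → (v j).ofLp ⬝ᵥ κ = 0 := by
    intro j hj
    -- the constant vector is a nonzero multiple of `v j`
    have hexp : (WithLp.toLp 2 (fun _ : Fin m => (1 : ℝ))) =
        ((v j).ofLp ⬝ᵥ (fun _ => (1 : ℝ))) • v j := by
      rw [← v.sum_repr' (WithLp.toLp 2 (fun _ : Fin m => (1 : ℝ)))]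
      rw [Finset.sum_eq_single j]
      · rw [hinner]
      · intro i _ hij
        rw [hinner, horth i, zero_smul]
        intro hi
        apply hij
        apply e.injective
        apply Fin.ext
        rw [hi, hj]
      · intro h; exact absurd (Finset.mem_univ j) h
    have hfun : (fun _ : Fin m => (1 : ℝ)) =
        ((v j).ofLp ⬝ᵥ (fun _ => (1 : ℝ))) • (v j).ofLp := by
      have := congrArg WithLp.ofLp hexp
      simpa using this
    have h0 : (fun _ : Fin m => (1 : ℝ)) ⬝ᵥ κ = 0 := by simpa [dotProduct] using hκ
    rw [hfun, smul_dotProduct, smul_eq_mul] at h0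
    rcases mul_eq_zero.mp h0 with h | h
    · exfalso
      rw [h, zero_smul] at hfun
      have := congrFun hfun ⟨0, by omega⟩
      simp at this
    · exact h
  have h1 := hsum (fun i => κ i - g * (laplacian a *ᵥ κ) i)
  rw [h1, hsum κ, Finset.mul_sum]
  refine Finset.sum_le_sum fun j _ => ?_
  have h2 : (v j).ofLp ⬝ᵥ (fun i => κ i - g * (laplacian a *ᵥ κ) i) =
      (1 - g * hL.eigenvalues j) * ((v j).ofLp ⬝ᵥ κ) := by
    have : (fun i => κ i - g * (laplacian a *ᵥ κ) i) = κ - g • (laplacian a *ᵥ κ) := by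
      ext i; simp
    rw [this, dotProduct_sub, dotProduct_smul, hcoef, smul_eq_mul]; ring
  rw [h2, mul_pow]
  by_cases hj : (e j : ℕ) = m - 1
  · rw [hker j hj]; simp
  · exact mul_le_mul_of_nonneg_right (hg _ (hloc j hj).1 (hloc j hj).2) (sq_nonneg _)

theorem mu2_nonneg (ha : a.IsSymm) (ha0 : ∀ i j, 0 ≤ a i j) (hm : 2 ≤ m) : 0 ≤ mu2 ha hm := by
  rw [mu2, laplacianEig]
  have h := (laplacian_posSemidef ha ha0).eigenvalues_nonneg
  have h2 := h ((Fintype.equivOfCardEq (Fintype.card_fin (Fintype.card (Fin m))))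
    (Fin.cast (Fintype.card_fin m).symm (Fin.rev ⟨1, by omega⟩)))
  rw [Matrix.IsHermitian.eigenvalues, Equiv.symm_apply_apply] at h2
  exact h2

theorem mu2_le_muMax (ha : a.IsSymm) (hm : 2 ≤ m) : mu2 ha hm ≤ muMax ha hm := by
  apply (laplacian_isHermitian ha).eigenvalues₀_antitone
  rw [Fin.le_def]
  simp [Fin.rev]
  omega

end Graph

/-! ### Contraction of the disagreement -/

theorem continuous_quadForm {n : ℕ} (P : Matrix (Fin n) (Fin n) ℝ) :
    Continuous fun x : Fin n → ℝ => x ⬝ᵥ (P *ᵥ x) :=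
  continuous_id.dotProduct (Continuous.matrix_mulVec continuous_const continuous_id)

/-- Every quadratic form is dominated by a multiple of a positive definite one. -/
theorem exists_quadForm_le {n : ℕ} (P : Matrix (Fin n) (Fin n) ℝ)
    {R : Matrix (Fin n) (Fin n) ℝ} (hR : R.PosDef) :
    ∃ C : ℝ, 1 ≤ C ∧ ∀ x : Fin n → ℝ, x ⬝ᵥ (P *ᵥ x) ≤ C * (x ⬝ᵥ (R *ᵥ x)) := by
  have hRpos : ∀ x : Fin n → ℝ, x ≠ 0 → 0 < x ⬝ᵥ (R *ᵥ x) := fun x hx => by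
    simpa using hR.dotProduct_mulVec_pos hx
  have hne : ∀ x ∈ Metric.sphere (0 : Fin n → ℝ) 1, x ≠ 0 := by
    rintro x hx rfl
    simp at hx
  have hcont : ContinuousOn (fun x : Fin n → ℝ => x ⬝ᵥ (P *ᵥ x) / (x ⬝ᵥ (R *ᵥ x)))
      (Metric.sphere 0 1) :=
    (continuous_quadForm P).continuousOn.div (continuous_quadForm R).continuousOn
      fun x hx => (hRpos x (hne x hx)).ne'
  obtain ⟨C, hC⟩ := (isCompact_sphere (0 : Fin n → ℝ) 1).bddAbove_image hcont
  refine ⟨max 1 C, le_max_left _ _, fun x => ?_⟩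
  by_cases hx : x = 0
  · simp [hx]
  have hnx : 0 < ‖x‖ := norm_pos_iff.mpr hx
  set y := ‖x‖⁻¹ • x with hy
  have hys : y ∈ Metric.sphere (0 : Fin n → ℝ) 1 := by
    rw [mem_sphere_zero_iff_norm, hy, norm_smul, norm_inv, norm_norm,
      inv_mul_cancel₀ hnx.ne']
  have hyC : y ⬝ᵥ (P *ᵥ y) / (y ⬝ᵥ (R *ᵥ y)) ≤ C := hC ⟨y, hys, rfl⟩
  have hyR := hRpos y (hne y hys)
  rw [div_le_iff₀ hyR] at hyC
  have hyC' : y ⬝ᵥ (P *ᵥ y) ≤ max 1 C * (y ⬝ᵥ (R *ᵥ y)) :=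
    hyC.trans (mul_le_mul_of_nonneg_right (le_max_right _ _) hyR.le)
  have hscale : ∀ Q : Matrix (Fin n) (Fin n) ℝ,
      x ⬝ᵥ (Q *ᵥ x) = ‖x‖ ^ 2 * (y ⬝ᵥ (Q *ᵥ y)) := by
    intro Q
    rw [hy, Matrix.mulVec_smul, smul_dotProduct, dotProduct_smul, smul_eq_mul, smul_eq_mul]
    field_simp
  rw [hscale P, hscale R]
  have := mul_le_mul_of_nonneg_left hyC' (sq_nonneg ‖x‖)
  linarith

theorem quadForm_add_le {n : ℕ} {P : Matrix (Fin n) (Fin n) ℝ} (hP : P.PosDef) {s : ℝ}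
    (hs : 0 < s) (x y : Fin n → ℝ) :
    (x + y) ⬝ᵥ (P *ᵥ (x + y)) ≤
      (1 + s) * (x ⬝ᵥ (P *ᵥ x)) + (1 + s⁻¹) * (y ⬝ᵥ (P *ᵥ y)) := by
  have hPt : Pᵀ = P := by
    rw [← Matrix.conjTranspose_eq_transpose_of_trivial]; exact hP.isHermitian
  have h0 : 0 ≤ (s • x - y) ⬝ᵥ (P *ᵥ (s • x - y)) := by
    simpa using hP.posSemidef.dotProduct_mulVec_nonneg (s • x - y)
  simp only [Matrix.mulVec_sub, Matrix.mulVec_smul, sub_dotProduct, dotProduct_sub,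
    smul_dotProduct, dotProduct_smul, smul_eq_mul, dotProduct_mulVec_comm hPt y x] at h0
  simp only [Matrix.mulVec_add, add_dotProduct, dotProduct_add, dotProduct_mulVec_comm hPt y x]
  have h1 := mul_le_mul_of_nonneg_left h0 (inv_pos.mpr hs).le
  have h2 : s⁻¹ * s = 1 := inv_mul_cancel₀ hs.ne'
  have h4 : s⁻¹ * (s * (s * x ⬝ᵥ P *ᵥ x) - s * x ⬝ᵥ P *ᵥ y -
      (s * x ⬝ᵥ P *ᵥ y - y ⬝ᵥ P *ᵥ y)) =
      s * x ⬝ᵥ P *ᵥ x - 2 * x ⬝ᵥ P *ᵥ y + s⁻¹ * y ⬝ᵥ P *ᵥ y := by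
    field_simp; ring
  nlinarith

/-- A solution of the Riccati inequality contracts by a uniform factor. -/
theorem SolvesRiccati.exists_rate {n : ℕ} {S P : Matrix (Fin n) (Fin n) ℝ} {B : Fin n → ℝ}
    {ζ : ℝ} (h : SolvesRiccati S B ζ P) :
    ∃ r : ℝ, 0 ≤ r ∧ r < 1 ∧ ∀ x : Fin n → ℝ,
      (S *ᵥ x) ⬝ᵥ (P *ᵥ (S *ᵥ x)) -
        (1 - ζ ^ 2) / (B ⬝ᵥ (P *ᵥ B)) * (B ⬝ᵥ (P *ᵥ (S *ᵥ x))) ^ 2 ≤ r * (x ⬝ᵥ (P *ᵥ x)) := by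
  have hPt : Pᵀ = P := by
    rw [← Matrix.conjTranspose_eq_transpose_of_trivial]; exact h.1.isHermitian
  obtain ⟨C, hC1, hC⟩ := exists_quadForm_le P h.2
  have hC0 : 0 < C := by linarith
  -- C bounds P by a multiple of the Riccati residual, so each step loses at least the fraction C⁻¹;
  -- C ≥ 1 keeps the rate nonnegative.
  refine ⟨1 - C⁻¹, sub_nonneg.mpr (inv_le_one_of_one_le₀ hC1), by
    have := inv_pos.mpr hC0; linarith, fun x => ?_⟩
  have h1 := hC x
  rw [dotProduct_riccati S P B x _ hPt] at h1
  have h2 := mul_le_mul_of_nonneg_left h1 (inv_pos.mpr hC0).le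
  rw [← mul_assoc, inv_mul_cancel₀ hC0.ne', one_mul] at h2
  linarith

/-- One noise-free step of the disagreement dynamics contracts the Lyapunov function. -/
theorem sum_quadForm_step_le {m n : ℕ} {a : Matrix (Fin m) (Fin m) ℝ} (ha : a.IsSymm)
    (hm : 2 ≤ m) (hmu : 0 < mu2 ha hm)
    {S P : Matrix (Fin n) (Fin n) ℝ} {B : Fin n → ℝ} (hB : B ≠ 0) {ζ r : ℝ} (hζ : 0 < ζ)
    (hζm : ζ⁻¹ * (1 - mu2 ha hm / muMax ha hm) ≤ 1 + mu2 ha hm / muMax ha hm)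
    (hP : P.PosDef)
    (hr : ∀ x : Fin n → ℝ, (S *ᵥ x) ⬝ᵥ (P *ᵥ (S *ᵥ x)) -
        (1 - ζ ^ 2) / (B ⬝ᵥ (P *ᵥ B)) * (B ⬝ᵥ (P *ᵥ (S *ᵥ x))) ^ 2 ≤ r * (x ⬝ᵥ (P *ᵥ x)))
    (D F : Fin m → Fin n → ℝ) (hD : ∑ i, D i = 0)
    (hF : ∀ i, F i = S *ᵥ D i +
      (gain S B (mu2 ha hm) (muMax ha hm) P ⬝ᵥ ∑ j, a i j • (D j - D i)) • B) :
    ∑ i, F i ⬝ᵥ (P *ᵥ F i) ≤ r * ∑ i, D i ⬝ᵥ (P *ᵥ D i) := by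
  have hPt : Pᵀ = P := by
    rw [← Matrix.conjTranspose_eq_transpose_of_trivial]; exact hP.isHermitian
  have hle := mu2_le_muMax ha hm
  set μ₂ := mu2 ha hm with hμ₂
  set μₘ := muMax ha hm with hμₘ
  have hμₘ0 : 0 < μₘ := by linarith
  set β := B ⬝ᵥ (P *ᵥ B) with hβ
  have hβ0 : 0 < β := by simpa using hP.dotProduct_mulVec_pos hB
  set g := 2 / (μ₂ + μₘ) with hg
  set ρ : (Fin n → ℝ) → ℝ := fun x => B ⬝ᵥ (P *ᵥ (S *ᵥ x)) with hρ
  set κ : Fin m → ℝ := fun i => β⁻¹ * ρ (D i) with hκ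
  have hgain : ∀ x, gain S B μ₂ μₘ P ⬝ᵥ x = g * (β⁻¹ * ρ x) := by
    intro x
    rw [gain, smul_dotProduct, smul_dotProduct, ← Matrix.dotProduct_mulVec,
      ← Matrix.mulVec_mulVec]
    rfl
  have hu : ∀ i, gain S B μ₂ μₘ P ⬝ᵥ ∑ j, a i j • (D j - D i) =
      - (g * (laplacian a *ᵥ κ) i) := by
    intro i
    rw [dotProduct_sum, laplacian_mulVec, Finset.mul_sum, ← Finset.sum_neg_distrib]
    refine Finset.sum_congr rfl fun j _ => ?_
    rw [dotProduct_smul, dotProduct_sub, hgain, hgain, smul_eq_mul, hκ]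
    ring
  have hκsum : ∑ i, κ i = 0 := by
    have h1 : ∑ i, κ i = β⁻¹ * ρ (∑ i, D i) := by
      simp only [hκ, hρ, ← Finset.mul_sum, Matrix.mulVec_sum, dotProduct_sum]
    rw [h1, hD, hρ]
    simp
  -- The gain g centres [μ₂, μₘ] so that |1 - gt| peaks at both ends with value (μₘ - μ₂)/(μₘ + μ₂),
  -- at most ζ by `hζm`.
  have hspec : ∀ t, μ₂ ≤ t → t ≤ μₘ → (1 - g * t) ^ 2 ≤ ζ ^ 2 := by
    intro t h1 h2
    have hs : 0 < μ₂ + μₘ := by linarith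
    have h3 : μₘ - μ₂ ≤ ζ * (μ₂ + μₘ) := by
      have h4 := mul_le_mul_of_nonneg_left hζm (mul_pos hζ hμₘ0).le
      have e1 : ζ * μₘ * (ζ⁻¹ * (1 - μ₂ / μₘ)) = μₘ - μ₂ := by field_simp
      have e2 : ζ * μₘ * (1 + μ₂ / μₘ) = ζ * (μ₂ + μₘ) := by field_simp; ring
      rwa [e1, e2] at h4
    have h5 : |1 - g * t| ≤ ζ := by
      have e3 : 1 - g * t = (μ₂ + μₘ - 2 * t) / (μ₂ + μₘ) := by rw [hg]; field_simp
      rw [e3, abs_div, abs_of_pos hs, div_le_iff₀ hs, abs_le]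
      constructor <;> linarith
    exact sq_le_sq' (by linarith [neg_abs_le (1 - g * t)]) (by linarith [le_abs_self (1 - g * t)])
  have hcon := sum_sq_sub_laplacian_le ha hm hmu.ne' hspec hmu.le κ hκsum
  have hquad : ∀ i, F i ⬝ᵥ (P *ᵥ F i) = (S *ᵥ D i) ⬝ᵥ (P *ᵥ (S *ᵥ D i)) +
      β * ((κ i - g * (laplacian a *ᵥ κ) i) ^ 2 - κ i ^ 2) := by
    intro i
    have e1 : ρ (D i) = β * κ i := by rw [hκ]; field_simp
    rw [hF, hu]
    set c := g * (laplacian a *ᵥ κ) i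
    rw [neg_smul, ← sub_eq_add_neg, Matrix.mulVec_sub, Matrix.mulVec_smul, sub_dotProduct,
      dotProduct_sub, dotProduct_sub, smul_dotProduct, smul_dotProduct, dotProduct_smul,
      dotProduct_smul, dotProduct_mulVec_comm hPt (S *ᵥ D i) B, ← hβ]
    change _ - c • ρ (D i) - (c • ρ (D i) - _) = _
    rw [e1]
    simp only [smul_eq_mul]
    ring
  have hlow : ∀ i, (S *ᵥ D i) ⬝ᵥ (P *ᵥ (S *ᵥ D i)) ≤
      r * (D i ⬝ᵥ (P *ᵥ D i)) + (1 - ζ ^ 2) * (β * κ i ^ 2) := by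
    intro i
    have h1 := hr (D i)
    have e1 : (1 - ζ ^ 2) / β * (B ⬝ᵥ (P *ᵥ (S *ᵥ D i))) ^ 2 =
        (1 - ζ ^ 2) * (β * κ i ^ 2) := by
      have : B ⬝ᵥ (P *ᵥ (S *ᵥ D i)) = β * κ i := by simp only [hκ, hρ]; field_simp
      rw [this]; field_simp
    rw [e1] at h1
    linarith
  calc ∑ i, F i ⬝ᵥ (P *ᵥ F i)
      = ∑ i, (S *ᵥ D i) ⬝ᵥ (P *ᵥ (S *ᵥ D i)) +
          β * (∑ i, (κ i - g * (laplacian a *ᵥ κ) i) ^ 2 - ∑ i, κ i ^ 2) := by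
        rw [← Finset.sum_sub_distrib, Finset.mul_sum, ← Finset.sum_add_distrib]
        exact Finset.sum_congr rfl fun i _ => hquad i
    _ ≤ ∑ i, (r * (D i ⬝ᵥ (P *ᵥ D i)) + (1 - ζ ^ 2) * (β * κ i ^ 2)) +
          β * (ζ ^ 2 * ∑ i, κ i ^ 2 - ∑ i, κ i ^ 2) := by
        apply add_le_add (Finset.sum_le_sum fun i _ => hlow i)
        exact mul_le_mul_of_nonneg_left (by linarith) hβ0.le
    _ = r * ∑ i, D i ⬝ᵥ (P *ᵥ D i) := by
        rw [Finset.sum_add_distrib, ← Finset.mul_sum, ← Finset.mul_sum, ← Finset.mul_sum]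
        ring

/-- One noisy step: contraction up to the energy of the perturbation. -/
theorem exists_lyapunov_step {m n : ℕ} {a : Matrix (Fin m) (Fin m) ℝ} (ha : a.IsSymm)
    (hm : 2 ≤ m) (hmu : 0 < mu2 ha hm)
    {S P : Matrix (Fin n) (Fin n) ℝ} {B : Fin n → ℝ} (hB : B ≠ 0) {ζ : ℝ} (hζ : 0 < ζ)
    (hζm : ζ⁻¹ * (1 - mu2 ha hm / muMax ha hm) ≤ 1 + mu2 ha hm / muMax ha hm)
    (hP : SolvesRiccati S B ζ P) :
    ∃ r C : ℝ, 0 ≤ r ∧ r < 1 ∧ 0 ≤ C ∧ ∀ D D' w : Fin m → Fin n → ℝ, ∑ i, D i = 0 →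
      (∀ i, D' i = S *ᵥ D i +
        (gain S B (mu2 ha hm) (muMax ha hm) P ⬝ᵥ ∑ j, a i j • (D j - D i)) • B + w i) →
      ∑ i, D' i ⬝ᵥ (P *ᵥ D' i) ≤ r * ∑ i, D i ⬝ᵥ (P *ᵥ D i) + C * ∑ i, w i ⬝ᵥ w i := by
  obtain ⟨r, hr0, hr1, hr⟩ := hP.exists_rate
  obtain ⟨K, hK1, hK⟩ := exists_quadForm_le P (Matrix.PosDef.one (n := Fin n) (R := ℝ))
  -- The Young parameter is small enough that (1 + s)r ≤ (1 + r)/2 < 1.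
  obtain ⟨s, hs⟩ : ∃ s, s = (1 - r) / 2 := ⟨_, rfl⟩
  have hs0 : 0 < s := by linarith
  have hs1 := inv_pos.mpr hs0
  refine ⟨(1 + r) / 2, (1 + s⁻¹) * K, by linarith, by linarith, by positivity,
    fun D D' w hD hD' => ?_⟩
  have hstep := sum_quadForm_step_le ha hm hmu hB hζ hζm hP.1 hr D _ hD (fun i => rfl)
  set F : Fin m → Fin n → ℝ := fun i => S *ᵥ D i +
    (gain S B (mu2 ha hm) (muMax ha hm) P ⬝ᵥ ∑ j, a i j • (D j - D i)) • B with hF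
  have hV : 0 ≤ ∑ i, D i ⬝ᵥ (P *ᵥ D i) := Finset.sum_nonneg fun i _ => by
    simpa using hP.1.posSemidef.dotProduct_mulVec_nonneg (D i)
  calc ∑ i, D' i ⬝ᵥ (P *ᵥ D' i)
      ≤ ∑ i, ((1 + s) * (F i ⬝ᵥ (P *ᵥ F i)) + (1 + s⁻¹) * (K * (w i ⬝ᵥ w i))) := by
        refine Finset.sum_le_sum fun i _ => ?_
        rw [hD' i]
        refine (quadForm_add_le hP.1 hs0 (F i) (w i)).trans ?_
        have := hK (w i)
        rw [Matrix.one_mulVec] at this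
        gcongr
    _ = (1 + s) * ∑ i, F i ⬝ᵥ (P *ᵥ F i) + (1 + s⁻¹) * K * ∑ i, w i ⬝ᵥ w i := by
        rw [Finset.sum_add_distrib, ← Finset.mul_sum, ← Finset.mul_sum, ← Finset.mul_sum]
        ring
    _ ≤ (1 + r) / 2 * ∑ i, D i ⬝ᵥ (P *ᵥ D i) + (1 + s⁻¹) * K * ∑ i, w i ⬝ᵥ w i := by
        apply add_le_add _ le_rfl
        have h1 := mul_le_mul_of_nonneg_left hstep (by linarith : 0 ≤ 1 + s)
        have h2 : (1 + s) * r ≤ (1 + r) / 2 := by rw [hs]; nlinarith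
        have h3 := mul_le_mul_of_nonneg_right h2 hV
        linarith

/-! ### Uniform second-moment bounds -/

section BoundedMoments

variable {Ω : Type*} [MeasurableSpace Ω] {ν : Measure Ω}

/-- Scalar processes bounded in `L²`, uniformly in time. -/
def BddL2 (f : ℕ → Ω → ℝ) (ν : Measure Ω) : Prop :=
  (∀ k, MemLp (f k) 2 ν) ∧ ∃ C : ℝ, ∀ k, ∫ ω, f k ω ^ 2 ∂ν ≤ C

theorem BddL2.add {f g : ℕ → Ω → ℝ} (hf : BddL2 f ν) (hg : BddL2 g ν) :
    BddL2 (fun k ω => f k ω + g k ω) ν := by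
  obtain ⟨hf1, C, hC⟩ := hf
  obtain ⟨hg1, C', hC'⟩ := hg
  refine ⟨fun k => (hf1 k).add (hg1 k), 2 * C + 2 * C', fun k => ?_⟩
  calc ∫ ω, (f k ω + g k ω) ^ 2 ∂ν ≤ ∫ ω, (2 * f k ω ^ 2 + 2 * g k ω ^ 2) ∂ν := by
        apply integral_mono ((hf1 k).add (hg1 k)).integrable_sq
          (((hf1 k).integrable_sq.const_mul 2).add ((hg1 k).integrable_sq.const_mul 2))
        intro ω
        simp only [Pi.add_apply]
        nlinarith [sq_nonneg (f k ω - g k ω)]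
    _ = 2 * ∫ ω, f k ω ^ 2 ∂ν + 2 * ∫ ω, g k ω ^ 2 ∂ν := by
        rw [integral_add ((hf1 k).integrable_sq.const_mul 2) ((hg1 k).integrable_sq.const_mul 2),
          integral_const_mul, integral_const_mul]
    _ ≤ 2 * C + 2 * C' := by linarith [hC k, hC' k]

theorem BddL2.const_mul {f : ℕ → Ω → ℝ} (hf : BddL2 f ν) (c : ℝ) :
    BddL2 (fun k ω => c * f k ω) ν := by
  obtain ⟨hf1, C, hC⟩ := hf
  refine ⟨fun k => (hf1 k).const_mul c, c ^ 2 * C, fun k => ?_⟩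
  simp only [mul_pow]
  rw [integral_const_mul]
  exact mul_le_mul_of_nonneg_left (hC k) (sq_nonneg c)

theorem BddL2.sub {f g : ℕ → Ω → ℝ} (hf : BddL2 f ν) (hg : BddL2 g ν) :
    BddL2 (fun k ω => f k ω - g k ω) ν := by
  simpa [sub_eq_add_neg] using hf.add (hg.const_mul (-1))

theorem BddL2.sum {ι : Type*} (s : Finset ι) {f : ι → ℕ → Ω → ℝ}
    (hf : ∀ i ∈ s, BddL2 (f i) ν) : BddL2 (fun k ω => ∑ i ∈ s, f i k ω) ν := by
  classical
  induction s using Finset.induction_on with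
  | empty => exact ⟨fun k => by simp, 0, fun k => by simp⟩
  | insert i s hi ih =>
    simp only [Finset.sum_insert hi]
    exact (hf i (Finset.mem_insert_self i s)).add
      (ih fun j hj => hf j (Finset.mem_insert_of_mem hj))

theorem BddL2.of_sq_le [IsProbabilityMeasure ν] {f : ℕ → Ω → ℝ}
    (hf : ∀ k, AEStronglyMeasurable (f k) ν) {C : ℝ} (hC : ∀ k ω, f k ω ^ 2 ≤ C) :
    BddL2 f ν := by
  have hm : ∀ k, MemLp (f k) 2 ν := fun k =>
    MemLp.of_bound (hf k) (√C) (Filter.Eventually.of_forall fun ω => by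
      rw [Real.norm_eq_abs]; exact Real.abs_le_sqrt (hC k ω))
  refine ⟨hm, C, fun k => ?_⟩
  calc ∫ ω, f k ω ^ 2 ∂ν ≤ ∫ _, C ∂ν :=
        integral_mono (hm k).integrable_sq (integrable_const C) (hC k)
    _ = C := by simp

/-- With zero mean, a diagonal entry of the covariance is a second moment, and the Loewner bound
controls the diagonal. -/
theorem IsBoundedNoise.bddL2 [IsProbabilityMeasure ν] {d : ℕ} {z : ℕ → Ω → Fin d → ℝ}
    (hz : IsBoundedNoise z ν) (b : Fin d) : BddL2 (fun k ω => z k ω b) ν := by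
  obtain ⟨h1, h2, Z, hZ⟩ := hz
  have hcomp : ∀ k c, MemLp (fun ω => z k ω c) 2 ν := fun k => memLp_pi_iff.mp (h1 k)
  refine ⟨fun k => hcomp k b, Z b b, fun k => ?_⟩
  have hmean : ∫ ω, z k ω b ∂ν = 0 := by
    rw [← eval_integral (fun c => (hcomp k c).integrable (by norm_num)), h2 k]; rfl
  have h3 := (hZ k).diag_nonneg (i := b)
  have h4 : covMatrix (z k) ν b b = ∫ ω, z k ω b ^ 2 ∂ν := by
    simp only [covMatrix, Matrix.of_apply, covariance, hmean, sub_zero, sq]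
  rw [Matrix.sub_apply, h4] at h3
  linarith

theorem integrable_quadForm {n : ℕ} (P : Matrix (Fin n) (Fin n) ℝ) {X : Ω → Fin n → ℝ}
    (hX : ∀ b, MemLp (fun ω => X ω b) 2 ν) : Integrable (fun ω => X ω ⬝ᵥ (P *ᵥ X ω)) ν := by
  simp only [dotProduct, Matrix.mulVec]
  refine integrable_finsetSum _ fun b _ => ?_
  have : MemLp (fun ω => ∑ c, P b c * X ω c) 2 ν :=
    memLp_finsetSum _ fun c _ => (hX c).const_mul (P b c)
  exact (hX b).integrable_mul this

theorem integrable_dotProduct_self {n : ℕ} {X : Ω → Fin n → ℝ}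
    (hX : ∀ b, MemLp (fun ω => X ω b) 2 ν) : Integrable (fun ω => X ω ⬝ᵥ X ω) ν := by
  simpa using integrable_quadForm 1 hX

/-- yᵀ cov(X) y = Var(y·X) ≤ E(y·X)² ≤ |y|² E|X|². -/
theorem covMatrix_le_of_integral_le [IsProbabilityMeasure ν] {n : ℕ} {X : Ω → Fin n → ℝ}
    (hX : ∀ b, MemLp (fun ω => X ω b) 2 ν) {C : ℝ} (hC : ∫ ω, X ω ⬝ᵥ X ω ∂ν ≤ C) :
    (C • (1 : Matrix (Fin n) (Fin n) ℝ) - covMatrix X ν).PosSemidef := by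
  refine Matrix.PosSemidef.of_dotProduct_mulVec_nonneg ?_ fun y => ?_
  · rw [Matrix.IsHermitian, Matrix.conjTranspose_eq_transpose_of_trivial, Matrix.transpose_sub,
      Matrix.transpose_smul, Matrix.transpose_one]
    congr 1
    ext b c
    simp only [covMatrix, Matrix.transpose_apply, Matrix.of_apply]
    exact covariance_comm _ _
  · rw [star_trivial, Matrix.sub_mulVec, Matrix.smul_mulVec, Matrix.one_mulVec, dotProduct_sub,
      dotProduct_smul, smul_eq_mul, sub_nonneg]
    have hyX : ∀ b, MemLp (fun ω => y b * X ω b) 2 ν := fun b => (hX b).const_mul (y b)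
    have hsum : MemLp (fun ω => ∑ b, y b * X ω b) 2 ν := memLp_finsetSum _ fun b _ => hyX b
    have h1 : y ⬝ᵥ (covMatrix X ν *ᵥ y) = Var[fun ω => ∑ b, y b * X ω b; ν] := by
      rw [← covariance_self hsum.aemeasurable, covariance_fun_sum_fun_sum hyX hyX]
      simp only [dotProduct, Matrix.mulVec, covMatrix, Matrix.of_apply, Finset.mul_sum,
        covariance_const_mul_left, covariance_const_mul_right]
      exact Finset.sum_congr rfl fun b _ => Finset.sum_congr rfl fun c _ => by ring
    rw [h1]
    calc Var[fun ω => ∑ b, y b * X ω b; ν] ≤ ∫ ω, (∑ b, y b * X ω b) ^ 2 ∂ν :=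
          variance_le_expectation_sq hsum.aestronglyMeasurable
      _ ≤ ∫ ω, (y ⬝ᵥ y) * (X ω ⬝ᵥ X ω) ∂ν := by
          apply integral_mono hsum.integrable_sq
            ((integrable_dotProduct_self hX).const_mul _)
          intro ω
          simp only [dotProduct, ← sq]
          exact Finset.sum_mul_sq_le_sq_mul_sq _ _ _
      _ = (y ⬝ᵥ y) * ∫ ω, X ω ⬝ᵥ X ω ∂ν := integral_const_mul _ _
      _ ≤ C * (y ⬝ᵥ y) := by
          rw [mul_comm]
          apply mul_le_mul_of_nonneg_right hC
          simpa using dotProduct_star_self_nonneg y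

/-- A Lyapunov recursion in expectation gives uniformly bounded second moments. -/
theorem exists_integral_le_of_recursion {m n : ℕ} {P : Matrix (Fin n) (Fin n) ℝ}
    (hP : P.PosDef) {r C : ℝ} (hr0 : 0 ≤ r) (hr1 : r < 1) (hC : 0 ≤ C)
    {D w : Fin m → ℕ → Ω → Fin n → ℝ}
    (hD : ∀ i k b, MemLp (fun ω => D i k ω b) 2 ν)
    (hw : ∀ i b, BddL2 (fun k ω => w i k ω b) ν)
    (hstep : ∀ k ω, ∑ i, D i (k + 1) ω ⬝ᵥ (P *ᵥ D i (k + 1) ω) ≤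
      r * ∑ i, D i k ω ⬝ᵥ (P *ᵥ D i k ω) + C * ∑ i, w i k ω ⬝ᵥ w i k ω) :
    ∃ K : ℝ, ∀ i k, ∫ ω, D i k ω ⬝ᵥ D i k ω ∂ν ≤ K := by
  have hDint : ∀ k, Integrable (fun ω => ∑ i, D i k ω ⬝ᵥ (P *ᵥ D i k ω)) ν := fun k =>
    integrable_finsetSum _ fun i _ => integrable_quadForm P (hD i k)
  have hwint : ∀ k, Integrable (fun ω => ∑ i, w i k ω ⬝ᵥ w i k ω) ν := fun k =>
    integrable_finsetSum _ fun i _ => integrable_dotProduct_self fun b => (hw i b).1 k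
  obtain ⟨W, hW⟩ : ∃ W : ℝ, ∀ k, ∫ ω, ∑ i, w i k ω ⬝ᵥ w i k ω ∂ν ≤ W := by
    choose W hW using fun i b => (hw i b).2
    refine ⟨∑ i, ∑ b, W i b, fun k => ?_⟩
    rw [integral_finsetSum _ fun i _ => integrable_dotProduct_self fun b => (hw i b).1 k]
    refine Finset.sum_le_sum fun i _ => ?_
    simp only [dotProduct, ← sq]
    rw [integral_finsetSum _ fun b _ => ((hw i b).1 k).integrable_sq]
    exact Finset.sum_le_sum fun b _ => hW i b k
  set V : ℕ → ℝ := fun k => ∫ ω, ∑ i, D i k ω ⬝ᵥ (P *ᵥ D i k ω) ∂ν with hV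
  have hVstep : ∀ k, V (k + 1) ≤ r * V k + C * W := by
    intro k
    calc V (k + 1) ≤ ∫ ω, (r * ∑ i, D i k ω ⬝ᵥ (P *ᵥ D i k ω) +
            C * ∑ i, w i k ω ⬝ᵥ w i k ω) ∂ν :=
          integral_mono (hDint (k + 1)) (((hDint k).const_mul r).add ((hwint k).const_mul C))
            (hstep k)
      _ = r * V k + C * ∫ ω, ∑ i, w i k ω ⬝ᵥ w i k ω ∂ν := by
          rw [integral_add ((hDint k).const_mul r) ((hwint k).const_mul C),
            integral_const_mul, integral_const_mul]
      _ ≤ r * V k + C * W := by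
          have := mul_le_mul_of_nonneg_left (hW k) hC
          linarith
  -- This maximum is preserved by V ↦ rV + CW.
  have hVbd : ∀ k, V k ≤ max (V 0) (C * W / (1 - r)) := by
    intro k
    induction k with
    | zero => exact le_max_left _ _
    | succ k ih =>
      set M := max (V 0) (C * W / (1 - r))
      have h1 : C * W ≤ M * (1 - r) := by
        rw [← div_le_iff₀ (by linarith)]; exact le_max_right _ _
      have h2 := mul_le_mul_of_nonneg_left ih hr0
      linarith [hVstep k]
  obtain ⟨K, hK1, hK⟩ := exists_quadForm_le 1 hP
  refine ⟨K * max (V 0) (C * W / (1 - r)), fun i k => ?_⟩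
  have hle : ∀ ω, D i k ω ⬝ᵥ D i k ω ≤ K * ∑ j, D j k ω ⬝ᵥ (P *ᵥ D j k ω) := by
    intro ω
    have h1 := hK (D i k ω)
    rw [Matrix.one_mulVec] at h1
    refine h1.trans (mul_le_mul_of_nonneg_left ?_ (by linarith))
    exact Finset.single_le_sum (f := fun j => D j k ω ⬝ᵥ (P *ᵥ D j k ω))
      (fun j _ => by simpa using hP.posSemidef.dotProduct_mulVec_nonneg (D j k ω))
      (Finset.mem_univ i)
  calc ∫ ω, D i k ω ⬝ᵥ D i k ω ∂ν ≤ ∫ ω, K * ∑ j, D j k ω ⬝ᵥ (P *ᵥ D j k ω) ∂ν :=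
        integral_mono (integrable_dotProduct_self (hD i k)) ((hDint k).const_mul K) hle
    _ = K * V k := integral_const_mul _ _
    _ ≤ K * max (V 0) (C * W / (1 - r)) :=
        mul_le_mul_of_nonneg_left (hVbd k) (by linarith)

end BoundedMoments

/-! ### Disagreement dynamics of the closed loop -/

section ClosedLoop

variable {m n : ℕ}

theorem average_apply (x : Fin m → Fin n → ℝ) (b : Fin n) :
    average x b = (m : ℝ)⁻¹ * ∑ i, x i b := by
  simp [average, Finset.sum_apply]

theorem sum_sub_average (hm : m ≠ 0) (x : Fin m → Fin n → ℝ) : ∑ i, (x i - average x) = 0 := by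
  rw [Finset.sum_sub_distrib, Finset.sum_const, Finset.card_univ, Fintype.card_fin, average,
    ← Nat.cast_smul_eq_nsmul ℝ, smul_smul, mul_inv_cancel₀ (by exact_mod_cast hm), one_smul,
    sub_self]

theorem sum_weighted_diff_eq_zero {a : Matrix (Fin m) (Fin m) ℝ} (ha : a.IsSymm)
    (y : Fin m → Fin n → ℝ) : ∑ i, ∑ j, a i j • (y j - y i) = 0 := by
  have h : ∑ i, ∑ j, a i j • (y j - y i) = -∑ i, ∑ j, a i j • (y j - y i) := by
    conv_lhs => rw [Finset.sum_comm]
    rw [← Finset.sum_neg_distrib]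
    refine Finset.sum_congr rfl fun i _ => ?_
    rw [← Finset.sum_neg_distrib]
    refine Finset.sum_congr rfl fun j _ => ?_
    rw [ha.apply, ← smul_neg, neg_sub]
  exact self_eq_neg.mp h

/-- The average is not affected by the diffusive coupling. -/
theorem average_step {a : Matrix (Fin m) (Fin m) ℝ} (ha : a.IsSymm)
    (S : Matrix (Fin n) (Fin n) ℝ) (B Γ : Fin n → ℝ) (x x' y v : Fin m → Fin n → ℝ)
    (h : ∀ i, x' i = S *ᵥ x i + (Γ ⬝ᵥ ∑ j, a i j • (y j - y i)) • B + v i) :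
    average x' = S *ᵥ average x + average v := by
  simp only [average, h, Finset.sum_add_distrib]
  rw [← Finset.sum_smul, ← dotProduct_sum, sum_weighted_diff_eq_zero ha, dotProduct_zero,
    zero_smul, add_zero, smul_add, Matrix.mulVec_smul, Matrix.mulVec_sum]

/-- The disagreement dynamics, with the estimation error `y - x` moved into the perturbation. -/
theorem disagreement_step {a : Matrix (Fin m) (Fin m) ℝ} (ha : a.IsSymm)
    (S : Matrix (Fin n) (Fin n) ℝ) (B Γ : Fin n → ℝ) (x x' y v : Fin m → Fin n → ℝ)
    (h : ∀ i, x' i = S *ᵥ x i + (Γ ⬝ᵥ ∑ j, a i j • (y j - y i)) • B + v i) (i : Fin m) :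
    x' i - average x' = S *ᵥ (x i - average x) +
      (Γ ⬝ᵥ ∑ j, a i j • ((x j - average x) - (x i - average x))) • B +
      ((Γ ⬝ᵥ ∑ j, a i j • ((y j - x j) - (y i - x i))) • B + (v i - average v)) := by
  have h1 : ∑ j, a i j • (y j - y i) = ∑ j, a i j • ((x j - average x) - (x i - average x)) +
      ∑ j, a i j • ((y j - x j) - (y i - x i)) := by
    rw [← Finset.sum_add_distrib]
    refine Finset.sum_congr rfl fun j _ => ?_
    rw [← smul_add]
    congr 1
    abel
  rw [average_step ha S B Γ x x' y v h, h i, h1, dotProduct_add, add_smul, Matrix.mulVec_sub]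
  abel

variable {Ω : Type*} [MeasurableSpace Ω] {ν : Measure Ω}

theorem aestronglyMeasurable_mulVec {d : ℕ} (M : Matrix (Fin n) (Fin d) ℝ) {X : Ω → Fin d → ℝ}
    (hX : AEStronglyMeasurable X ν) : AEStronglyMeasurable (fun ω => M *ᵥ X ω) ν :=
  (Continuous.matrix_mulVec continuous_const continuous_id).comp_aestronglyMeasurable hX

theorem aestronglyMeasurable_dotProduct (Γ : Fin n → ℝ) {X : Ω → Fin n → ℝ}
    (hX : AEStronglyMeasurable X ν) : AEStronglyMeasurable (fun ω => Γ ⬝ᵥ X ω) ν :=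
  (continuous_const.dotProduct continuous_id).comp_aestronglyMeasurable hX

theorem memLp_dotProduct (Γ : Fin n → ℝ) {X : Ω → Fin n → ℝ}
    (hX : ∀ b, MemLp (fun ω => X ω b) 2 ν) : MemLp (fun ω => Γ ⬝ᵥ X ω) 2 ν :=
  memLp_finsetSum _ fun b _ => (hX b).const_mul (Γ b)

theorem BddL2.dotProduct (Γ : Fin n → ℝ) {X : ℕ → Ω → Fin n → ℝ}
    (hX : ∀ b, BddL2 (fun k ω => X k ω b) ν) : BddL2 (fun k ω => Γ ⬝ᵥ X k ω) ν :=
  BddL2.sum _ fun b _ => (hX b).const_mul (Γ b)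

/-- Mean-square synchronization from the Riccati inequality. -/
theorem meanSquareSync_of_solvesRiccati [IsProbabilityMeasure ν] (hm : 2 ≤ m)
    {S P : Matrix (Fin n) (Fin n) ℝ} {B : Fin n → ℝ} (hB : B ≠ 0)
    {a : Matrix (Fin m) (Fin m) ℝ} (ha : a.IsSymm) (hmu : 0 < mu2 ha hm)
    {c₀ c₁ rho : ℝ} (hc₀ : 0 < c₀) (hc₁ : 0 < c₁) (hrho : rho ∈ Set.Ioo (0 : ℝ) 1)
    {q : Fin m → ℕ} (L : (i : Fin m) → Matrix (Fin n) (Fin (q i)) ℝ)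
    (z : (i : Fin m) → ℕ → Ω → Fin (q i) → ℝ) (hz : ∀ i, IsBoundedNoise (z i) ν)
    {ζ : ℝ} (hζ : 0 < ζ)
    (hζm : ζ⁻¹ * (1 - mu2 ha hm / muMax ha hm) ≤ 1 + mu2 ha hm / muMax ha hm)
    (hP : SolvesRiccati S B ζ P) (η : Fin m → ℕ → Ω → Fin n → ℝ)
    (hη0 : ∀ i, AEStronglyMeasurable (η i 0) ν)
    (hη2 : ∀ i, MemLp (fun ω => η i 0 ω - average fun j => η j 0 ω) 2 ν)
    (hcl : IsClosedLoop a S B (gain S B (mu2 ha hm) (muMax ha hm) P) c₀ c₁ rho L z η) :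
    MeanSquareSync S L z η ν := by
  obtain ⟨y, u, hheld, hu, hdyn⟩ := hcl
  set Γ := gain S B (mu2 ha hm) (muMax ha hm) P with hΓ
  simp only [hu] at hdyn
  refine ⟨fun k ω => average_step ha S B Γ _ _ (fun i => y i k ω) _ fun i => hdyn i k ω, ?_⟩
  -- measurability of the states and of their held estimates
  have hmeas : ∀ k, (∀ i, AEStronglyMeasurable (η i k) ν) ∧
      ∀ i, AEStronglyMeasurable (y i k) ν := by
    intro k
    induction k with
    | zero =>
      refine ⟨hη0, fun i => ?_⟩
      have : y i 0 = η i 0 := funext fun ω => (hheld i ω).zero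
      rw [this]; exact hη0 i
    | succ k ih =>
      have h1 : ∀ i, AEStronglyMeasurable (η i (k + 1)) ν := by
        intro i
        rw [funext (hdyn i k)]
        refine AEStronglyMeasurable.add (AEStronglyMeasurable.add ?_ ?_) ?_
        · exact aestronglyMeasurable_mulVec S (ih.1 i)
        · refine AEStronglyMeasurable.smul_const (aestronglyMeasurable_dotProduct Γ
            (Finset.aestronglyMeasurable_fun_sum _ fun j _ => ?_)) B
          exact ((ih.2 j).sub (ih.2 i)).const_smul (a i j)
        · exact aestronglyMeasurable_mulVec (L i) ((hz i).1 k).aestronglyMeasurable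
      exact ⟨h1, fun i => aestronglyMeasurable_heldEstimate (hheld i) k (h1 i) (ih.2 i)⟩
  set D : Fin m → ℕ → Ω → Fin n → ℝ := fun i k ω => η i k ω - average fun j => η j k ω with hD
  set v : Fin m → ℕ → Ω → Fin n → ℝ := fun i k ω => L i *ᵥ z i k ω with hv
  set w : Fin m → ℕ → Ω → Fin n → ℝ := fun i k ω =>
    (Γ ⬝ᵥ ∑ j, a i j • ((y j k ω - η j k ω) - (y i k ω - η i k ω))) • B +
      (v i k ω - average fun j => v j k ω) with hwd
  have hstepD : ∀ i k ω, D i (k + 1) ω = S *ᵥ D i k ω +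
      (Γ ⬝ᵥ ∑ j, a i j • (D j k ω - D i k ω)) • B + w i k ω := fun i k ω =>
    disagreement_step ha S B Γ (fun i => η i k ω) (fun i => η i (k + 1) ω) (fun i => y i k ω)
      (fun i => v i k ω) (fun i => hdyn i k ω) i
  -- The pointwise trigger bound gives an L² bound once measurability is known; the states
  -- themselves need not be square integrable.
  have herr : ∀ i b, BddL2 (fun k ω => (y i k ω - η i k ω) b) ν := by
    intro i b
    refine BddL2.of_sq_le (C := c₀ + c₁) (fun k => ?_) fun k ω => ?_
    · exact (continuous_apply b).comp_aestronglyMeasurable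
        (((hmeas k).2 i).sub ((hmeas k).1 i))
    · refine le_trans ?_ ((hheld i ω).norm_sub_sq_le hc₀ hc₁ hrho k)
      rw [EuclideanSpace.norm_sq_eq]
      simp only [Real.norm_eq_abs, sq_abs]
      exact Finset.single_le_sum (f := fun b => (y i k ω - η i k ω) b ^ 2)
        (fun _ _ => sq_nonneg _) (Finset.mem_univ b)
  have hvb : ∀ i b, BddL2 (fun k ω => v i k ω b) ν := fun i b =>
    BddL2.dotProduct (L i b) fun c => (hz i).bddL2 c
  have hwb : ∀ i b, BddL2 (fun k ω => w i k ω b) ν := by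
    intro i b
    simp only [hwd, Pi.add_apply, Pi.sub_apply, Pi.smul_apply, smul_eq_mul, average_apply]
    refine BddL2.add ?_ ((hvb i b).sub ((BddL2.sum _ fun j _ => hvb j b).const_mul _))
    simp only [mul_comm _ (B b)]
    refine BddL2.const_mul (BddL2.dotProduct Γ fun c => ?_) (B b)
    simp only [Finset.sum_apply, Pi.smul_apply, smul_eq_mul]
    exact BddL2.sum _ fun j _ => ((herr j c).sub (herr i c)).const_mul (a i j)
  -- Integrability at each fixed time, not yet uniform, is needed before expectations can be taken
  -- in the recursion.
  have hDmem : ∀ k i b, MemLp (fun ω => D i k ω b) 2 ν := by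
    intro k
    induction k with
    | zero => exact fun i => memLp_pi_iff.mp (hη2 i)
    | succ k ih =>
      intro i b
      simp only [hstepD, Pi.add_apply, Pi.smul_apply, smul_eq_mul]
      refine MemLp.add (MemLp.add ?_ ?_) ((hwb i b).1 k)
      · exact memLp_dotProduct (S b) (ih i)
      · simp only [mul_comm _ (B b)]
        refine MemLp.const_mul (memLp_dotProduct Γ fun c => ?_) (B b)
        simp only [Finset.sum_apply, Pi.smul_apply, Pi.sub_apply, smul_eq_mul]
        exact memLp_finsetSum _ fun j _ => ((ih j c).sub (ih i c)).const_mul (a i j)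
  obtain ⟨r, C, hr0, hr1, hC, hstep⟩ := exists_lyapunov_step ha hm hmu hB hζ hζm hP
  obtain ⟨K, hK⟩ := exists_integral_le_of_recursion hP.1 hr0 hr1 hC
    (fun i k b => hDmem k i b) hwb fun k ω =>
      hstep (fun i => D i k ω) (fun i => D i (k + 1) ω) (fun i => w i k ω)
        (sum_sub_average (by omega) _) fun i => hstepD i k ω
  exact ⟨K • 1, fun i k => ⟨memLp_pi_iff.mpr fun b => hDmem k i b,
    covMatrix_le_of_integral_le (hDmem k i) (hK i k)⟩⟩

end ClosedLoop

/-! ### Choice of ζ and conclusion -/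

theorem exists_admissibleZeta {n : ℕ} (S : Matrix (Fin n) (Fin n) ℝ) {μ₂ μₘ : ℝ}
    (hle : μ₂ / μₘ ≤ 1) (hM : mahlerOf S * (1 - μ₂ / μₘ) < 1 + μ₂ / μₘ) :
    ∃ ζ, AdmissibleZeta S μ₂ μₘ ζ := by
  have hM1 := one_le_mahlerOf S
  rcases hle.eq_or_lt with h | h
  -- When μ₂ = μₘ the upper bound is infinite, so any ζ⁻¹ above M(S) serves; otherwise ζ⁻¹ is the
  -- upper bound itself.
  · refine ⟨(mahlerOf S + 1)⁻¹, by positivity, ?_, ?_⟩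
    · rw [inv_inv]; linarith
    · rw [h]; norm_num
  · have h0 : 0 < 1 - μ₂ / μₘ := by linarith
    have h1 : mahlerOf S < (1 + μ₂ / μₘ) / (1 - μ₂ / μₘ) := by rwa [lt_div_iff₀ h0]
    refine ⟨((1 + μ₂ / μₘ) / (1 - μ₂ / μₘ))⁻¹, inv_pos.mpr (by linarith), ?_, ?_⟩
    · rwa [inv_inv]
    · rw [inv_inv, div_mul_cancel₀ _ h0.ne']

end EventSync

end

theorem theorem1 {Ω : Type*} [MeasurableSpace Ω] (ν : Measure Ω) [IsProbabilityMeasure ν]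
    {m n : ℕ} (hm : 2 ≤ m)
    (S : Matrix (Fin n) (Fin n) ℝ) (B : Fin n → ℝ)
    (hS : ∃ lam ∈ EventSync.complexEigenvalues S, 1 ≤ ‖lam‖)
    (hSB : EventSync.Controllable S B)
    (a : Matrix (Fin m) (Fin m) ℝ) (ha : a.IsSymm) (ha0 : ∀ i j, 0 ≤ a i j)
    (hconn : (EventSync.commGraph a).Connected)
    -- Mahler measure below `(1 + μ₂/μₘ) / (1 - μ₂/μₘ)`, a bound that is `+∞` if `μ₂ = μₘ`
    (hM : EventSync.mahlerOf S * (1 - EventSync.mu2 ha hm / EventSync.muMax ha hm) <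
      1 + EventSync.mu2 ha hm / EventSync.muMax ha hm)
    (c₀ c₁ rho : ℝ) (hc₀ : 0 < c₀) (hc₁ : 0 < c₁) (hrho : rho ∈ Set.Ioo (0 : ℝ) 1)
    {q : Fin m → ℕ} (L : (i : Fin m) → Matrix (Fin n) (Fin (q i)) ℝ)
    (z : (i : Fin m) → ℕ → Ω → Fin (q i) → ℝ) (hz : ∀ i, EventSync.IsBoundedNoise (z i) ν) :
    (∃ ζ, EventSync.AdmissibleZeta S (EventSync.mu2 ha hm) (EventSync.muMax ha hm) ζ) ∧
    ∀ ζ, EventSync.AdmissibleZeta S (EventSync.mu2 ha hm) (EventSync.muMax ha hm) ζ →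
      (∃ P, EventSync.SolvesRiccati S B ζ P) ∧
      ∀ P, EventSync.SolvesRiccati S B ζ P →
        ∀ η : Fin m → ℕ → Ω → Fin n → ℝ,
          (∀ i, AEStronglyMeasurable (η i 0) ν) →
          (∀ i, MemLp (fun ω => η i 0 ω - EventSync.average fun j => η j 0 ω) 2 ν) →
          EventSync.IsClosedLoop a S B
            (EventSync.gain S B (EventSync.mu2 ha hm) (EventSync.muMax ha hm) P)
            c₀ c₁ rho L z η →
          EventSync.MeanSquareSync S L z η ν := by
  have hM1 := EventSync.one_le_mahlerOf S
  have hn : n ≠ 0 := by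
    rintro rfl
    obtain ⟨lam, hlam, _⟩ := hS
    simp [EventSync.complexEigenvalues, Matrix.charpoly] at hlam
  have hnonneg := EventSync.mu2_nonneg ha ha0 hm
  have hle := EventSync.mu2_le_muMax ha hm
  have hmu : 0 < EventSync.mu2 ha hm := by
    -- If μ₂ were 0, `hM` would say M(S) < 1, against M(S) ≥ 1.
    refine lt_of_le_of_ne hnonneg fun h => ?_
    rw [← h] at hM
    simp only [zero_div, sub_zero, mul_one, add_zero] at hM
    linarith
  have hratio : EventSync.mu2 ha hm / EventSync.muMax ha hm ≤ 1 :=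
    (div_le_one (by linarith)).mpr hle
  refine ⟨EventSync.exists_admissibleZeta S hratio hM, fun ζ hζ => ⟨?_, fun P hP η h0 h2 hcl => ?_⟩⟩
  · exact EventSync.exists_solvesRiccati hSB hn hζ.1 hζ.2.1
  · exact EventSync.meanSquareSync_of_solvesRiccati hm (hSB.ne_zero hn) ha hmu hc₀ hc₁ hrho L z hz
      hζ.1 hζ.2.2 hP η h0 h2 hcl
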